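/- Let $n,M\ge 1$ and $p>n+M+1$ be integers, $\sigma\ge 0$ and $w_1^*,w_2^*\in\mathbb{R}^p$. Let $X_1,X_2\in\mathbb{R}^{p\times n}$ and $\widetilde X\in\mathbb{R}^{p\times M}$ have i.i.d. standard Gaussian entries, let $z_1,z_2\in\mathbb{R}^n$ and $\tilde z\in\mathbb{R}^M$ have i.i.d. $\mathcal N(0,\sigma^2)$ entries, all of these independent, and put $Y_1=X_1^\top w_1^*+z_1$, $Y_2=X_2^\top w_2^*+z_2$ (the data of tasks 1 and 2) and $\widetilde Y=\widetilde X^\top w_1^*+\tilde z$ (fresh memory data of task 1). Both strategies learn task 1 by $w_1=\arg\min\{\|w\|^2 : X_1^\top w=Y_1\}$. Concurrent rehearsal then takes $w_2=\arg\min\{\|w-w_1\|^2 : X_2^\top w=Y_2,\ \widetilde X^\top w=\widetilde Y\}$. Sequential rehearsal takes $w_2^{(0)}=\arg\min\{\|w-w_1\|^2 : X_2^\top w=Y_2\}$ and then $w_2=\arg\min\{\|w-w_2^{(0)}\|^2 : \widetilde X^\top w=\widetilde Y\}$. For each strategy let $$F_2=\mathbb{E}\big[\|w_2-w_1^*\|^2-\|w_1-w_1^*\|^2\big],\qquad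 G_2=\tfrac12\big(\mathbb{E}\|w_2-w_1^*\|^2+\mathbb{E}\|w_2-w_2^*\|^2\big).$$ Let $K=\frac{nM}{p^2}\left(1-\frac np\right)$, $N=\frac{n+M}{p-n-M-1}-\left(1-\frac Mp+\frac{nM}{p^2}\right)\frac{n}{p-n-1}-\frac{M}{p-M-1}$ and $$\xi_1=\frac{1}{K}\cdot\frac{nM}{p}\left(\frac{1}{p-n-M-1}+\frac1p\right),\quad \xi_2=\frac{N}{K},\quad \mu_1=\frac1K\cdot\frac{nM}{p}\left(\frac{2}{p-n-M-1}+\frac1p-\frac{n}{p^2}\right),\quad \mu_2=\frac{2N}{K}.$$ Then $\xi_1,\xi_2,\mu_1,\mu_2$ are positive; almost surely each of the minimization problems has a unique solution, and all the expectations above are finite. If $w_1^*\neq 0$, then $$F_2^{(\mathrm{concurrent})}>F_2^{(\mathrm{sequential})}\iff \frac{\xi_1\|w_1^*-w_2^*\|^2+\xi_2\sigma^2}{\|w_1^*\|^2}>1,$$ and if $w_1^*$ and $w_2^*$ are not both $0$, then $$G_2^{(\mathrm{concurrent})}>G_2^{(\mathrm{sequential})}\iff \frac{\mu_1\|w_1^*-w_2^*\|^2+\mu_2\sigma^2}{\|w_1^*\|^2+\|w_2^*\|^2}>1.$$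 -/

import Mathlib

open MeasureTheory ProbabilityTheory
open scoped NNReal

noncomputable section

namespace Rehearsal

/-- Parameter space `ℝ^p` with the Euclidean norm. -/
abbrev Param (p : ℕ) : Type := EuclideanSpace ℝ (Fin p)

/-- Model error of `w` with respect to the ground truth `wstar`. -/
def modelError {p : ℕ} (wstar w : Param p) : ℝ := ‖w - wstar‖ ^ 2

/-- Outputs `Y = Xᵀ wstar + z` of the linear ground truth model. The columns of `X` are the
features of the samples. -/
def outputs {p m : ℕ} (X : Matrix (Fin p) (Fin m) ℝ) (wstar : Param p) (z : Fin m → ℝ) :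
    Fin m → ℝ :=
  Matrix.mulVec X.transpose wstar.ofLp + z

/-- The parameters that fit the data set `(X, Y)` exactly: `Xᵀ w = Y`. -/
def fits {p m : ℕ} (X : Matrix (Fin p) (Fin m) ℝ) (Y : Fin m → ℝ) : Set (Param p) :=
  {w | Matrix.mulVec X.transpose w.ofLp = Y}

/-- `w` solves the problem: minimize `‖w - w₀‖²` subject to `w ∈ S`. -/
def IsClosest {p : ℕ} (S : Set (Param p)) (w₀ w : Param p) : Prop :=
  w ∈ S ∧ ∀ v ∈ S, ‖w - w₀‖ ^ 2 ≤ ‖v - w₀‖ ^ 2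

open Classical in
/-- The training result: the point of the constraint set `S` closest to the initial point `w₀`
(and `w₀` itself if the minimization problem has no solution). -/
def train {p : ℕ} (S : Set (Param p)) (w₀ : Param p) : Param p :=
  if h : ∃ w, IsClosest S w₀ w then h.choose else w₀

/-- The random features and noises of two tasks (`n` samples each) and of the memory data set of
the first task that is used while the second task is learned (`M` fresh samples). -/
structure TwoTaskData (Ω : Type*) (p n M : ℕ) where
  X₁ : Ω → Matrix (Fin p) (Fin n) ℝ
  X₂ : Ω → Matrix (Fin p) (Fin n) ℝ
  Xmem : Ω → Matrix (Fin p) (Fin M) ℝ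
  z₁ : Ω → Fin n → ℝ
  z₂ : Ω → Fin n → ℝ
  zmem : Ω → Fin M → ℝ

namespace TwoTaskData

variable {Ω : Type*} {p n M : ℕ}

/-- All features, as a family of real random variables: the first index runs over the samples of
task 1, of task 2 and of the memory, the second one over the coordinates. -/
def feature (D : TwoTaskData Ω p n M) : (Fin n ⊕ Fin n ⊕ Fin M) × Fin p → Ω → ℝ
  | (Sum.inl i, j) => fun ω => D.X₁ ω j i
  | (Sum.inr (Sum.inl i), j) => fun ω => D.X₂ ω j i
  | (Sum.inr (Sum.inr i), j) => fun ω => D.Xmem ω j i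

/-- All noises, as a family of real random variables. -/
def noise (D : TwoTaskData Ω p n M) : Fin n ⊕ Fin n ⊕ Fin M → Ω → ℝ
  | Sum.inl i => fun ω => D.z₁ ω i
  | Sum.inr (Sum.inl i) => fun ω => D.z₂ ω i
  | Sum.inr (Sum.inr i) => fun ω => D.zmem ω i

/-- Standard Gaussian features and `N(0, σ²)` noises, all of them independent. -/
structure IsGaussian [MeasurableSpace Ω] (D : TwoTaskData Ω p n M) (P : Measure Ω) (σ : ℝ≥0) :
    Prop where
  feature_law : ∀ k, HasLaw (D.feature k) (gaussianReal 0 1) P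
  noise_law : ∀ k, HasLaw (D.noise k) (gaussianReal 0 (σ ^ 2)) P
  indep : iIndepFun (Sum.elim D.feature D.noise) P

variable (D : TwoTaskData Ω p n M) (w₁star w₂star : Param p)

/-- Constraint set of the data set of task 1. -/
def fitsTask₁ (ω : Ω) : Set (Param p) := fits (D.X₁ ω) (outputs (D.X₁ ω) w₁star (D.z₁ ω))

/-- Constraint set of the data set of task 2. -/
def fitsTask₂ (ω : Ω) : Set (Param p) := fits (D.X₂ ω) (outputs (D.X₂ ω) w₂star (D.z₂ ω))

/-- Constraint set of the memory data set, whose samples come from task 1. -/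
def fitsMemory (ω : Ω) : Set (Param p) := fits (D.Xmem ω) (outputs (D.Xmem ω) w₁star (D.zmem ω))

/-- Parameters after task 1 (for both strategies), trained from the initial point `0`. -/
def afterTask₁ (ω : Ω) : Param p := train (D.fitsTask₁ w₁star ω) 0

/-- Concurrent rehearsal: parameters after training jointly on task 2 and on the memory. -/
def concurrent (ω : Ω) : Param p :=
  train (D.fitsTask₂ w₂star ω ∩ D.fitsMemory w₁star ω) (D.afterTask₁ w₁star ω)

/-- Sequential rehearsal, first stage: parameters after training on task 2 alone. -/
def sequentialStage (ω : Ω) : Param p :=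
  train (D.fitsTask₂ w₂star ω) (D.afterTask₁ w₁star ω)

/-- Sequential rehearsal: parameters after revisiting the memory. -/
def sequential (ω : Ω) : Param p :=
  train (D.fitsMemory w₁star ω) (D.sequentialStage w₁star w₂star ω)

end TwoTaskData

/-- Forgetting `F₂` for two tasks, where `w₁`, `w₂` are the (random) parameters after tasks
1 and 2. -/
def forgetting {Ω : Type*} [MeasurableSpace Ω] {p : ℕ} (P : Measure Ω) (w₁star : Param p)
    (w₁ w₂ : Ω → Param p) : ℝ :=
  ∫ ω, (modelError w₁star (w₂ ω) - modelError w₁star (w₁ ω)) ∂P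

/-- Generalization error `G₂` for two tasks, where `w₂` are the (random) parameters after
task 2. -/
def generalizationError {Ω : Type*} [MeasurableSpace Ω] {p : ℕ} (P : Measure Ω)
    (w₁star w₂star : Param p) (w₂ : Ω → Param p) : ℝ :=
  1 / 2 * ((∫ ω, modelError w₁star (w₂ ω) ∂P) + ∫ ω, modelError w₂star (w₂ ω) ∂P)

/-- The constant `ξ₁`. -/
def xi₁ (p n M : ℝ) : ℝ :=
  (n * M / p * (1 / (p - n - M - 1) + 1 / p)) / (n * M / p ^ 2 * (1 - n / p))

/-- The constant `ξ₂`. -/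
def xi₂ (p n M : ℝ) : ℝ :=
  ((n + M) / (p - n - M - 1) - (1 - M / p + n * M / p ^ 2) * (n / (p - n - 1))
    - M / (p - M - 1)) / (n * M / p ^ 2 * (1 - n / p))

/-- The constant `μ₁`. -/
def mu₁ (p n M : ℝ) : ℝ :=
  (n * M / p * (2 / (p - n - M - 1) + 1 / p - n / p ^ 2)) / (n * M / p ^ 2 * (1 - n / p))

/-- The constant `μ₂`. -/
def mu₂ (p n M : ℝ) : ℝ :=
  2 * ((n + M) / (p - n - M - 1) - (1 - M / p + n * M / p ^ 2) * (n / (p - n - 1))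
    - M / (p - M - 1)) / (n * M / p ^ 2 * (1 - n / p))

end Rehearsal

end

/-! Training on k samples from `w₀` replaces the error `w₀ - wstar` by its component orthogonal to
the span of the features, plus a vector of that span: the minimum-norm interpolant of the labels'
deviations from those of `wstar`. The two pieces are orthogonal, so squared norms add
(`modelError_add_interp`). The batch is independent of `w₀`, and projecting a fixed vector onto the
span of k Gaussian vectors keeps on average the fraction k/p of its squared norm. Hence a round acts
on expected squared errors by e ↦ (1 - k/p) e + r, with r the expected squared norm of the
interpolant (`integrable_modelError_trainBatch_comp`).

In every round needed, the parameter generating a label differs from `wstar` either by 0 or by one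
common vector d. For such 0/1 masks `integrable_norm_sq_maskedInterp` computes r by adding one
sample at a time. A new feature x contributes residual²/‖q‖², where q is the part of x orthogonal to
the earlier features. Given the earlier data, q is standard Gaussian in dimension m = p - k,
independent of the rest of x, and only two means are needed: 1/(m - 2) for 1/‖q‖² and ‖f‖²/m for ⟪q,
f⟫²/‖q‖², with f in that subspace.

Concurrent rehearsal is one round of n + M samples after task 1; sequential rehearsal is a round of
n followed by a round of M. Composing the affine maps and subtracting gives a positive factor K
times (weighted sum - squared norms) for F₂ and for 2G₂ (`forgetting_gap`, `generalization_gap`),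
and the equivalences read off its sign. -/

noncomputable section

namespace Rehearsal

/-! ### Gaussian moments of ratios of quadratic forms. -/

section Gaussian
open Module Set
open scoped RealInnerProductSpace

/-- For a nonnegative function the section integrals are the section integrals of its norm, so
integrability of `g` already gives joint integrability. Every expectation below is found to be
finite and evaluated at once by conditioning in this way. -/
lemma integrable_prod_of_nonneg {α β : Type*} [MeasurableSpace α] [MeasurableSpace β]
    {μ : Measure α} {ν : Measure β} [SFinite μ] [SFinite ν] {φ : α × β → ℝ} {g : α → ℝ}
    (hm : AEStronglyMeasurable φ (μ.prod ν)) (h0 : ∀ z, 0 ≤ φ z)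
    (hs : ∀ᵐ x ∂μ, Integrable (fun y => φ (x, y)) ν ∧ ∫ y, φ (x, y) ∂ν = g x)
    (hg : Integrable g μ) :
    Integrable φ (μ.prod ν) ∧ ∫ z, φ z ∂(μ.prod ν) = ∫ x, g x ∂μ := by
  have hi : Integrable φ (μ.prod ν) := by
    rw [integrable_prod_iff hm]
    refine ⟨hs.mono fun x hx => hx.1, hg.congr ?_⟩
    filter_upwards [hs] with x hx
    simp_rw [Real.norm_of_nonneg (h0 _)]
    exact hx.2.symm
  refine ⟨hi, ?_⟩
  rw [integral_prod _ hi]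
  exact integral_congr_ae (hs.mono fun x hx => hx.2)

lemma integral_exp_neg_mul_sq_gaussianReal {t : ℝ} (ht : 0 ≤ t) :
    ∫ x, Real.exp (-(t * x ^ 2 / 2)) ∂(gaussianReal 0 1) = (1 + t) ^ (-(1 / 2) : ℝ) := by
  rw [integral_gaussianReal_eq_integral_smul one_ne_zero]
  simp only [gaussianPDFReal, smul_eq_mul, sub_zero, NNReal.coe_one, mul_one]
  have : ∀ x : ℝ, (√(2 * Real.pi))⁻¹ * Real.exp (-x ^ 2 / 2) * Real.exp (-(t * x ^ 2 / 2))
      = (√(2 * Real.pi))⁻¹ * Real.exp (-((1 + t) / 2) * x ^ 2) := by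
    intro x
    rw [mul_assoc, ← Real.exp_add]
    ring_nf
  simp_rw [this]
  rw [integral_const_mul, integral_gaussian, ← Real.sqrt_inv, ← Real.sqrt_mul (by positivity),
    Real.rpow_neg (by positivity), ← Real.sqrt_eq_rpow, ← Real.sqrt_inv]
  congr 1
  field_simp

variable {F : Type*} [NormedAddCommGroup F] [InnerProductSpace ℝ F] [FiniteDimensional ℝ F]
  [MeasurableSpace F] [BorelSpace F]

lemma integral_exp_neg_mul_norm_sq {t : ℝ} (ht : 0 ≤ t) :
    ∫ x, Real.exp (-(t * ‖x‖ ^ 2 / 2)) ∂(stdGaussian F) = (1 + t) ^ (-(finrank ℝ F / 2 : ℝ)) := by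
  rw [stdGaussian, integral_map (Measurable.aemeasurable (by fun_prop))
    (Measurable.aestronglyMeasurable (by fun_prop))]
  have h : ∀ x : Fin (finrank ℝ F) → ℝ,
      Real.exp (-(t * ‖∑ i, x i • stdOrthonormalBasis ℝ F i‖ ^ 2 / 2))
        = ∏ i, Real.exp (-(t * x i ^ 2 / 2)) := by
    intro x
    rw [← Real.exp_sum, ← (stdOrthonormalBasis ℝ F).sum_sq_inner_right]
    congr 1
    simp only [inner_sum, real_inner_smul_right, OrthonormalBasis.inner_eq_ite]
    simp [Finset.mul_sum, Finset.sum_div]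
  simp_rw [h]
  rw [integral_fintype_prod_eq_pow (f := fun x : ℝ => Real.exp (-(t * x ^ 2 / 2))),
    integral_exp_neg_mul_sq_gaussianReal ht,
    ← Real.rpow_natCast, ← Real.rpow_mul (by positivity), Fintype.card_fin]
  congr 1
  ring

lemma ae_inner_ne_zero_stdGaussian {f : F} (hf : f ≠ 0) : ∀ᵐ x ∂(stdGaussian F), ⟪x, f⟫ ≠ 0 := by
  have h := IsGaussian.map_eq_gaussianReal (μ := stdGaussian F) (innerSL ℝ f)
  have hv : (Var[innerSL ℝ f; stdGaussian F]).toNNReal ≠ 0 := by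
    rw [variance_dual_stdGaussian, innerSL_apply_norm]
    have : 0 < ‖f‖ := norm_pos_iff.2 hf
    simpa using this.ne'
  have := nullSingletonClass_gaussianReal (μ := (stdGaussian F)[innerSL ℝ f]) hv
  have h0 : ∀ᵐ y ∂((stdGaussian F).map (innerSL ℝ f)), y ≠ 0 := by
    rw [h]
    exact Measure.ae_ne _ 0
  filter_upwards [ae_of_ae_map (Measurable.aemeasurable (by fun_prop)) h0] with x hx
  rwa [real_inner_comm]

lemma ae_ne_zero_stdGaussian (h : 0 < finrank ℝ F) : ∀ᵐ x ∂(stdGaussian F), x ≠ 0 := by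
  have : Nontrivial F := finrank_pos_iff.1 h
  obtain ⟨f, hf⟩ := exists_ne (0 : F)
  filter_upwards [ae_inner_ne_zero_stdGaussian hf] with x hx h0
  simp [h0] at hx

lemma lintegral_exp_neg_mul_Ioi {a : ℝ} (ha : 0 < a) :
    ∫⁻ t in Ioi (0 : ℝ), ENNReal.ofReal (Real.exp (-(t * a / 2))) = ENNReal.ofReal (2 / a) := by
  have e : ∀ t : ℝ, -(t * a / 2) = -(a / 2) * t := fun t => by ring
  simp_rw [e]
  have ha' : -(a / 2) < 0 := by linarith
  rw [← ofReal_integral_eq_lintegral_ofReal (integrableOn_exp_mul_Ioi ha' 0)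
    (Filter.Eventually.of_forall fun t => (Real.exp_pos _).le), integral_exp_mul_Ioi ha' 0]
  congr 1
  simp

/-- Since 2/‖x‖² = ∫₀^∞ exp(-t‖x‖²/2) dt, Tonelli and the Gaussian Laplace transform reduce the mean
to ∫₀^∞ (1 + t)^(-m/2) dt = 2/(m - 2), where m is the dimension; convergence needs m > 2. -/
lemma integrable_inv_norm_sq (h : 3 ≤ finrank ℝ F) :
    Integrable (fun x : F => 1 / ‖x‖ ^ 2) (stdGaussian F) ∧
      ∫ x, 1 / ‖x‖ ^ 2 ∂(stdGaussian F) = 1 / (finrank ℝ F - 2 : ℝ) := by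
  have h3 : (3 : ℝ) ≤ finrank ℝ F := by exact_mod_cast h
  have key : ∫⁻ x, ENNReal.ofReal (2 / ‖x‖ ^ 2) ∂(stdGaussian F)
      = ENNReal.ofReal (2 / (finrank ℝ F - 2 : ℝ)) := by
    have h1 : ∫⁻ x, ENNReal.ofReal (2 / ‖x‖ ^ 2) ∂(stdGaussian F) = ∫⁻ x, ∫⁻ t in Ioi (0 : ℝ),
        ENNReal.ofReal (Real.exp (-(t * ‖x‖ ^ 2 / 2))) ∂volume ∂(stdGaussian F) := by
      refine lintegral_congr_ae ?_
      filter_upwards [ae_ne_zero_stdGaussian (F := F) (by omega)] with x hx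
      rw [lintegral_exp_neg_mul_Ioi (by positivity)]
    rw [h1, lintegral_lintegral_swap (Measurable.aemeasurable (by fun_prop))]
    have h2 : ∀ t ∈ Ioi (0 : ℝ), ∫⁻ x, ENNReal.ofReal (Real.exp (-(t * ‖x‖ ^ 2 / 2)))
        ∂(stdGaussian F) = ENNReal.ofReal ((t + 1) ^ (-(finrank ℝ F / 2 : ℝ))) := by
      intro t ht
      have ht : 0 < t := ht
      rw [← ofReal_integral_eq_lintegral_ofReal, integral_exp_neg_mul_norm_sq ht.le, add_comm]
      · refine Integrable.of_bound (C := 1) (Measurable.aestronglyMeasurable (by fun_prop)) ?_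
        refine Filter.Eventually.of_forall fun x => ?_
        rw [Real.norm_of_nonneg (Real.exp_pos _).le, Real.exp_le_one_iff]
        simp only [Left.neg_nonpos_iff]
        positivity
      · exact Filter.Eventually.of_forall fun t => (Real.exp_pos _).le
    rw [setLIntegral_congr_fun measurableSet_Ioi h2]
    have hc : -(finrank ℝ F / 2 : ℝ) < -1 := by linarith
    rw [← ofReal_integral_eq_lintegral_ofReal
      (integrableOn_add_rpow_Ioi_of_lt hc (by norm_num))]
    · congr 1
      have := (measurePreserving_add_right volume (1 : ℝ)).setIntegral_preimage_emb
        (measurableEmbedding_addRight 1) (fun t : ℝ => t ^ (-(finrank ℝ F / 2 : ℝ))) (Ioi 1)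
      simp only [preimage_add_const_Ioi, sub_self] at this
      rw [this, integral_Ioi_rpow_of_lt hc one_pos]
      have h4 : (finrank ℝ F : ℝ) - 2 ≠ 0 := by linarith
      have h5 : -(finrank ℝ F : ℝ) / 2 + 1 ≠ 0 := by
        intro h; apply h4; linarith
      simp only [Real.one_rpow]
      rw [div_eq_div_iff (by intro h; apply h4; linarith) h4]
      ring
    · filter_upwards [ae_restrict_mem measurableSet_Ioi] with t ht
      have ht : 0 < t := ht
      positivity
  have hi : Integrable (fun x : F => 2 / ‖x‖ ^ 2) (stdGaussian F) := by
    refine ⟨Measurable.aestronglyMeasurable (by fun_prop), ?_⟩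
    rw [hasFiniteIntegral_iff_ofReal (Filter.Eventually.of_forall fun x => by positivity), key]
    exact ENNReal.ofReal_lt_top
  have hv : ∫ x, 2 / ‖x‖ ^ 2 ∂(stdGaussian F) = 2 / (finrank ℝ F - 2 : ℝ) := by
    rw [integral_eq_lintegral_of_nonneg_ae (Filter.Eventually.of_forall fun x => by positivity)
      hi.aestronglyMeasurable, key, ENNReal.toReal_ofReal]
    exact div_nonneg (by norm_num) (by linarith)
  have e : ∀ x : F, 1 / ‖x‖ ^ 2 = 1 / 2 * (2 / ‖x‖ ^ 2) := fun x => by ring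
  simp_rw [e]
  refine ⟨hi.const_mul _, ?_⟩
  rw [integral_const_mul, hv]
  ring

lemma integrable_inner_stdGaussian (f : F) :
    Integrable (fun x : F => ⟪x, f⟫) (stdGaussian F) := by
  simp_rw [real_inner_comm f]
  have h : Integrable (id : F → F) (stdGaussian F) := IsGaussian.integrable_id
  exact (innerSL ℝ f).integrable_comp h

lemma integral_inner_stdGaussian (f : F) : ∫ x, ⟪x, f⟫ ∂(stdGaussian F) = 0 := by
  simp_rw [real_inner_comm f]
  exact integral_strongDual_stdGaussian (innerSL ℝ f)

lemma integrable_inner_sq_stdGaussian (f : F) :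
    Integrable (fun x : F => ⟪x, f⟫ ^ 2) (stdGaussian F) := by
  simp_rw [real_inner_comm f]
  have h : MemLp (innerSL ℝ f ∘ id) 2 (stdGaussian F) :=
    (innerSL ℝ f).comp_memLp' IsGaussian.memLp_two_id
  exact h.integrable_sq

lemma integral_inner_sq_stdGaussian (f : F) :
    ∫ x, ⟪x, f⟫ ^ 2 ∂(stdGaussian F) = ‖f‖ ^ 2 := by
  have h := variance_dual_stdGaussian (innerSL ℝ f)
  rw [variance_of_integral_eq_zero (by fun_prop)
    (integral_strongDual_stdGaussian _), innerSL_apply_norm] at h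
  simpa [real_inner_comm f] using h

lemma integrable_add_inner_sq_stdGaussian (c : ℝ) (f : F) :
    Integrable (fun x : F => (c + ⟪x, f⟫) ^ 2) (stdGaussian F) ∧
      ∫ x, (c + ⟪x, f⟫) ^ 2 ∂(stdGaussian F) = c ^ 2 + ‖f‖ ^ 2 := by
  have e : ∀ x : F, (c + ⟪x, f⟫) ^ 2 = (c ^ 2 + 2 * c * ⟪x, f⟫) + ⟪x, f⟫ ^ 2 := fun x => by ring
  simp_rw [e]
  have h1 := (integrable_inner_stdGaussian f).const_mul (2 * c)
  have h2 : Integrable (fun _ : F => c ^ 2) (stdGaussian F) := integrable_const _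
  refine ⟨(h2.add h1).add (integrable_inner_sq_stdGaussian f), ?_⟩
  have h3 := integral_add (h2.add h1) (integrable_inner_sq_stdGaussian f)
  simp only [Pi.add_apply] at h3
  rw [h3, integral_add h2 h1, integral_const_mul, integral_inner_stdGaussian, integral_inner_sq_stdGaussian]
  simp

omit [FiniteDimensional ℝ F] [MeasurableSpace F] [BorelSpace F] in
lemma inner_sq_div_norm_sq_le (x f : F) : ⟪x, f⟫ ^ 2 / ‖x‖ ^ 2 ≤ ‖f‖ ^ 2 := by
  refine div_le_of_le_mul₀ (by positivity) (by positivity) ?_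
  rw [← mul_pow, mul_comm, ← sq_abs]
  exact pow_le_pow_left₀ (abs_nonneg _) (abs_real_inner_le_norm x f) 2

lemma integrable_inner_sq_div_norm_sq (f : F) :
    Integrable (fun x : F => ⟪x, f⟫ ^ 2 / ‖x‖ ^ 2) (stdGaussian F) := by
  refine Integrable.of_bound (C := ‖f‖ ^ 2) (Measurable.aestronglyMeasurable (by fun_prop)) ?_
  refine Filter.Eventually.of_forall fun x => ?_
  rw [Real.norm_of_nonneg (by positivity)]
  exact inner_sq_div_norm_sq_le x f

lemma integral_inner_sq_div_norm_sq_of_norm_eq {f g : F} (h : ‖f‖ = ‖g‖) :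
    ∫ x, ⟪x, f⟫ ^ 2 / ‖x‖ ^ 2 ∂(stdGaussian F) = ∫ x, ⟪x, g⟫ ^ 2 / ‖x‖ ^ 2 ∂(stdGaussian F) := by
  -- The reflection in the hyperplane orthogonal to f - g sends f to g and preserves the Gaussian
  -- law.
  let r := (Submodule.span ℝ {f - g})ᗮ.reflection
  have hr : r f = g := Submodule.reflection_sub h
  conv_rhs => rw [← stdGaussian_map r]
  rw [integral_map (by fun_prop) (Measurable.aestronglyMeasurable (by fun_prop))]
  refine integral_congr_ae (Filter.Eventually.of_forall fun x => ?_)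
  simp only [← hr, LinearIsometryEquiv.inner_map_map, LinearIsometryEquiv.norm_map]

/-- By rotation invariance all vectors of an orthonormal basis give the same value, and these values
sum to 1 by Parseval. -/
lemma integral_inner_sq_div_norm_sq (h : 0 < finrank ℝ F) (f : F) :
    ∫ x, ⟪x, f⟫ ^ 2 / ‖x‖ ^ 2 ∂(stdGaussian F) = ‖f‖ ^ 2 / finrank ℝ F := by
  let b := stdOrthonormalBasis ℝ F
  let I := ∫ x, ⟪x, b ⟨0, h⟩⟫ ^ 2 / ‖x‖ ^ 2 ∂(stdGaussian F)
  have h1 : ∀ i, ∫ x, ⟪x, b i⟫ ^ 2 / ‖x‖ ^ 2 ∂(stdGaussian F) = I := fun i =>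
    integral_inner_sq_div_norm_sq_of_norm_eq (by simp)
  have h2 : ∑ i, ∫ x, ⟪x, b i⟫ ^ 2 / ‖x‖ ^ 2 ∂(stdGaussian F) = 1 := by
    rw [← integral_finsetSum _ fun i _ => integrable_inner_sq_div_norm_sq (b i)]
    have : ∫ _ : F, (1 : ℝ) ∂(stdGaussian F) = 1 := by simp
    rw [← this]
    refine integral_congr_ae ?_
    filter_upwards [ae_ne_zero_stdGaussian h] with x hx
    rw [← Finset.sum_div, b.sum_sq_inner_left, div_self]
    simpa using hx
  simp_rw [h1] at h2
  simp only [Finset.sum_const, Finset.card_univ, Fintype.card_fin, nsmul_eq_mul] at h2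
  have h3 : ∫ x, ⟪x, f⟫ ^ 2 / ‖x‖ ^ 2 ∂(stdGaussian F) = ‖f‖ ^ 2 * I := by
    rw [integral_inner_sq_div_norm_sq_of_norm_eq (g := ‖f‖ • b ⟨0, h⟩) (by simp [norm_smul]),
      ← integral_const_mul]
    simp_rw [real_inner_smul_right]
    congr with x
    ring
  have hne : (finrank ℝ F : ℝ) ≠ 0 := by positivity
  rw [h3, eq_div_iff hne, mul_assoc, mul_comm I, h2, mul_one]

lemma integrable_add_inner_sq_div_norm_sq (h : 3 ≤ finrank ℝ F) (c : ℝ) (f : F) :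
    Integrable (fun x : F => (c + ⟪x, f⟫) ^ 2 / ‖x‖ ^ 2) (stdGaussian F) ∧
      ∫ x, (c + ⟪x, f⟫) ^ 2 / ‖x‖ ^ 2 ∂(stdGaussian F) =
        c ^ 2 / (finrank ℝ F - 2 : ℝ) + ‖f‖ ^ 2 / finrank ℝ F := by
  obtain ⟨h1, h1v⟩ := integrable_inv_norm_sq h
  have h2 := integrable_inner_sq_div_norm_sq f
  have h12 : Integrable (fun x : F => c ^ 2 * (1 / ‖x‖ ^ 2) + ⟪x, f⟫ ^ 2 / ‖x‖ ^ 2)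
    (stdGaussian F) := (h1.const_mul (c ^ 2)).add h2
  have h3 : Integrable (fun x : F => 2 * c * ⟪x, f⟫ / ‖x‖ ^ 2) (stdGaussian F) := by
    refine h12.mono' (Measurable.aestronglyMeasurable (by fun_prop)) ?_
    refine Filter.Eventually.of_forall fun x => ?_
    have e : c ^ 2 * (1 / ‖x‖ ^ 2) + ⟪x, f⟫ ^ 2 / ‖x‖ ^ 2 = (c ^ 2 + ⟪x, f⟫ ^ 2) / ‖x‖ ^ 2 := by
      ring
    rw [e, norm_div, Real.norm_of_nonneg (sq_nonneg ‖x‖)]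
    refine div_le_div_of_nonneg_right ?_ (sq_nonneg _)
    rw [Real.norm_eq_abs, abs_le]
    constructor <;> nlinarith [sq_nonneg (c - ⟪x, f⟫), sq_nonneg (c + ⟪x, f⟫)]
  -- The cross term is odd and the law is invariant under x ↦ -x.
  have h3v : ∫ x, 2 * c * ⟪x, f⟫ / ‖x‖ ^ 2 ∂(stdGaussian F) = 0 := by
    have : ∫ x, 2 * c * ⟪x, f⟫ / ‖x‖ ^ 2 ∂(stdGaussian F)
        = ∫ x, -(2 * c * ⟪x, f⟫ / ‖x‖ ^ 2) ∂(stdGaussian F) := by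
      conv_lhs => rw [← stdGaussian_map (LinearIsometryEquiv.neg ℝ (E := F))]
      rw [integral_map (by fun_prop) (Measurable.aestronglyMeasurable (by fun_prop))]
      refine integral_congr_ae (Filter.Eventually.of_forall fun x => ?_)
      simp only [LinearIsometryEquiv.coe_neg, inner_neg_left, norm_neg]
      ring
    rw [integral_neg] at this
    linarith
  have e : ∀ x : F, (c + ⟪x, f⟫) ^ 2 / ‖x‖ ^ 2 = (c ^ 2 * (1 / ‖x‖ ^ 2) + ⟪x, f⟫ ^ 2 / ‖x‖ ^ 2)
      + 2 * c * ⟪x, f⟫ / ‖x‖ ^ 2 := fun x => by ring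
  simp_rw [e]
  refine ⟨h12.add h3, ?_⟩
  rw [integral_add h12 h3, h3v, integral_add (h1.const_mul (c ^ 2)) h2, integral_const_mul, h1v,
    integral_inner_sq_div_norm_sq (by omega)]
  ring

/-- The components along S and its complement are independent standard Gaussians: the characteristic
function depends on ‖t‖² only, which splits by Pythagoras. -/
lemma map_orthogonal_decomposition_stdGaussian (S : Submodule ℝ F) :
    MeasurePreserving (fun x => (S.orthogonalProjectionOnto x, Sᗮ.orthogonalProjectionOnto x))
      (stdGaussian F) ((stdGaussian S).prod (stdGaussian Sᗮ)) := by
  refine ⟨by fun_prop, ?_⟩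
  rw [← charFun_eq_prod_iff]
  intro t
  rw [Measure.map_map (by fun_prop) (by fun_prop), charFun_apply,
    integral_map (by fun_prop) (by fun_prop)]
  have e : ∀ x : F, ⟪((WithLp.toLp 2) ∘ fun x : F => (S.orthogonalProjectionOnto x,
      Sᗮ.orthogonalProjectionOnto x)) x, t⟫ = ⟪x, (t.ofLp.1 : F) + t.ofLp.2⟫ := by
    intro x
    simp [WithLp.prod_inner_apply, inner_add_right]
  simp_rw [e]
  rw [← charFun_apply, charFun_stdGaussian, charFun_stdGaussian, charFun_stdGaussian,
    ← Complex.exp_add]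
  congr 1
  have : ‖(t.ofLp.1 : F) + t.ofLp.2‖ ^ 2 = ‖t.ofLp.1‖ ^ 2 + ‖t.ofLp.2‖ ^ 2 := by
    rw [norm_add_sq_real, Submodule.inner_right_of_mem_orthogonal (K := S) t.ofLp.1.2 t.ofLp.2.2]
    simp
  rw [← Complex.ofReal_pow, this]
  push_cast
  ring

/-- The denominator sees only the component in Sᗮ. With the S-component fixed, its inner product
with f is absorbed into the constant c; averaging over it then turns c² into c² + ‖P_S f‖². -/
lemma integrable_add_inner_sq_div_norm_starProjection_sq (S : Submodule ℝ F)
    (h : 3 ≤ finrank ℝ Sᗮ) (c : ℝ) (f : F) :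
    Integrable (fun x : F => (c + ⟪x, f⟫) ^ 2 / ‖Sᗮ.starProjection x‖ ^ 2) (stdGaussian F) ∧
      ∫ x, (c + ⟪x, f⟫) ^ 2 / ‖Sᗮ.starProjection x‖ ^ 2 ∂(stdGaussian F) =
        (c ^ 2 + ‖S.starProjection f‖ ^ 2) / (finrank ℝ Sᗮ - 2 : ℝ)
          + ‖Sᗮ.starProjection f‖ ^ 2 / finrank ℝ Sᗮ := by
  let f₁ := S.orthogonalProjectionOnto f
  let f₂ := Sᗮ.orthogonalProjectionOnto f
  let φ : S × Sᗮ → ℝ := fun y => ((c + ⟪y.1, f₁⟫) + ⟪y.2, f₂⟫) ^ 2 / ‖y.2‖ ^ 2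
  have hφ : Measurable φ := by fun_prop
  have e : (fun x : F => (c + ⟪x, f⟫) ^ 2 / ‖Sᗮ.starProjection x‖ ^ 2) =
      φ ∘ fun x => (S.orthogonalProjectionOnto x, Sᗮ.orthogonalProjectionOnto x) := by
    ext x
    have hx : ⟪x, f⟫ = ⟪S.orthogonalProjectionOnto x, f₁⟫ + ⟪Sᗮ.orthogonalProjectionOnto x, f₂⟫ := by
      simp [f₁, f₂, inner_sub_left]
    simp only [Function.comp, φ, hx, Submodule.starProjection_apply, Submodule.coe_norm, add_assoc]
  have hmp := map_orthogonal_decomposition_stdGaussian S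
  obtain ⟨hc, hcv⟩ := integrable_add_inner_sq_stdGaussian c f₁
  have hd := hc.div_const (finrank ℝ Sᗮ - 2 : ℝ)
  have hk : Integrable (fun _ : S => ‖f₂‖ ^ 2 / (finrank ℝ Sᗮ : ℝ)) (stdGaussian S) :=
    integrable_const _
  obtain ⟨hi, hv⟩ := integrable_prod_of_nonneg (μ := stdGaussian S) (ν := stdGaussian Sᗮ)
    (φ := φ) hφ.aestronglyMeasurable (fun z => by positivity)
    (Filter.Eventually.of_forall fun x => integrable_add_inner_sq_div_norm_sq h (c + ⟪x, f₁⟫) f₂)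
    (hd.add hk)
  rw [e]
  refine ⟨(hmp.integrable_comp hφ.aestronglyMeasurable).2 hi, ?_⟩
  have hmap := integral_map (μ := stdGaussian F) (φ := fun x =>
    (S.orthogonalProjectionOnto x, Sᗮ.orthogonalProjectionOnto x)) (f := φ)
    (by fun_prop) hφ.aestronglyMeasurable
  rw [hmp.map_eq] at hmap
  change ∫ x, φ (S.orthogonalProjectionOnto x, Sᗮ.orthogonalProjectionOnto x)
    ∂(stdGaussian F) = _
  rw [← hmap, hv, integral_add hd hk, integral_div, hcv]
  simp [f₁, f₂]

lemma integrable_noise_add_inner_sq_div_norm_starProjection_sq (v : ℝ≥0) (S : Submodule ℝ F)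
    (h : 3 ≤ finrank ℝ Sᗮ) (f : F) :
    Integrable (fun s : ℝ × F => (s.1 + ⟪s.2, f⟫) ^ 2 / ‖Sᗮ.starProjection s.2‖ ^ 2)
        ((gaussianReal 0 v).prod (stdGaussian F)) ∧
      ∫ s, (s.1 + ⟪s.2, f⟫) ^ 2 / ‖Sᗮ.starProjection s.2‖ ^ 2
          ∂((gaussianReal 0 v).prod (stdGaussian F)) =
        (v + ‖S.starProjection f‖ ^ 2) / (finrank ℝ Sᗮ - 2 : ℝ)
          + ‖Sᗮ.starProjection f‖ ^ 2 / finrank ℝ Sᗮ := by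
  have h2 : Integrable (fun z : ℝ => z ^ 2) (gaussianReal 0 v) :=
    (memLp_id_gaussianReal 2).integrable_sq
  have h2v : ∫ z, z ^ 2 ∂(gaussianReal 0 v) = v := by
    have := variance_id_gaussianReal (μ := 0) (v := v)
    rw [variance_of_integral_eq_zero (by fun_prop) (by simp)] at this
    simpa using this
  have hk : ∀ a : ℝ, Integrable (fun _ : ℝ => a) (gaussianReal 0 v) := fun a => integrable_const _
  have ha := (h2.add (hk (‖S.starProjection f‖ ^ 2))).div_const (finrank ℝ Sᗮ - 2 : ℝ)
  obtain ⟨hi, hv⟩ := integrable_prod_of_nonneg (μ := gaussianReal 0 v) (ν := stdGaussian F)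
    (φ := fun s : ℝ × F => (s.1 + ⟪s.2, f⟫) ^ 2 / ‖Sᗮ.starProjection s.2‖ ^ 2)
    (Measurable.aestronglyMeasurable (by fun_prop)) (fun z => by positivity)
    (Filter.Eventually.of_forall fun z =>
      integrable_add_inner_sq_div_norm_starProjection_sq S h z f)
    (ha.add (hk (‖Sᗮ.starProjection f‖ ^ 2 / finrank ℝ Sᗮ)))
  refine ⟨hi, ?_⟩
  rw [hv]
  simp only [Pi.add_apply] at ha
  rw [integral_add ha (hk _), integral_div, integral_add h2 (hk _), h2v]
  simp

lemma integrable_inner_starProjection_sq_div_norm_sq (S : Submodule ℝ F)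
    (h : 0 < finrank ℝ Sᗮ) (f : F) :
    Integrable (fun x : F => ⟪Sᗮ.starProjection x, f⟫ ^ 2 / ‖Sᗮ.starProjection x‖ ^ 2)
        (stdGaussian F) ∧
      ∫ x, ⟪Sᗮ.starProjection x, f⟫ ^ 2 / ‖Sᗮ.starProjection x‖ ^ 2 ∂(stdGaussian F) =
        ‖Sᗮ.starProjection f‖ ^ 2 / finrank ℝ Sᗮ := by
  let f₂ := Sᗮ.orthogonalProjectionOnto f
  let φ : Sᗮ → ℝ := fun y => ⟪y, f₂⟫ ^ 2 / ‖y‖ ^ 2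
  have hφ : Measurable φ := by fun_prop
  have e : (fun x : F => ⟪Sᗮ.starProjection x, f⟫ ^ 2 / ‖Sᗮ.starProjection x‖ ^ 2) =
      φ ∘ fun x => Sᗮ.orthogonalProjectionOnto x := by
    ext x
    simp only [Function.comp, φ, Submodule.coe_norm, Submodule.starProjection_apply]
    congr 2
    simp [f₂]
  have hmp : MeasurePreserving (fun x => Sᗮ.orthogonalProjectionOnto x) (stdGaussian F)
      (stdGaussian Sᗮ) :=
    measurePreserving_snd.comp (map_orthogonal_decomposition_stdGaussian S)
  rw [e]
  refine ⟨(hmp.integrable_comp hφ.aestronglyMeasurable).2 (integrable_inner_sq_div_norm_sq f₂), ?_⟩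
  have hmap := integral_map (μ := stdGaussian F) (φ := fun x => Sᗮ.orthogonalProjectionOnto x)
    (f := φ) (by fun_prop) hφ.aestronglyMeasurable
  rw [hmp.map_eq] at hmap
  change ∫ x, φ (Sᗮ.orthogonalProjectionOnto x) ∂(stdGaussian F) = _
  rw [← hmap, integral_inner_sq_div_norm_sq h]
  simp [f₂]

lemma ae_notMem_stdGaussian (S : Submodule ℝ F) (h : 0 < finrank ℝ Sᗮ) :
    ∀ᵐ x ∂(stdGaussian F), x ∉ S := by
  have : Nontrivial Sᗮ := finrank_pos_iff.1 h
  obtain ⟨f, hf⟩ := exists_ne (0 : Sᗮ)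
  filter_upwards [ae_inner_ne_zero_stdGaussian (f := (f : F)) (by simpa using hf)] with x hx hxS
  exact hx (Submodule.inner_right_of_mem_orthogonal hxS f.2)

end Gaussian

/-! ### Minimum-norm interpolation, one constraint at a time. -/

section Interpolation
open Module Set Submodule
open scoped RealInnerProductSpace

variable {E : Type*} [NormedAddCommGroup E] [InnerProductSpace ℝ E] [FiniteDimensional ℝ E]

/-- The span of a finite family of vectors. -/
abbrev dataSpan {k : ℕ} (xs : Fin k → E) : Submodule ℝ E := span ℝ (range xs)

/-- The minimum-norm solution of `⟪xs i, u⟫ = ys i`, computed by adding one constraint at a time. -/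
def interp : {k : ℕ} → (Fin k → E) → (Fin k → ℝ) → E
  | 0, _, _ => 0
  | k + 1, xs, ys =>
    interp (Fin.init xs) (Fin.init ys) +
      ((ys (Fin.last k) - ⟪xs (Fin.last k), interp (Fin.init xs) (Fin.init ys)⟫) /
        ‖(dataSpan (Fin.init xs))ᗮ.starProjection (xs (Fin.last k))‖ ^ 2) •
        (dataSpan (Fin.init xs))ᗮ.starProjection (xs (Fin.last k))

omit [FiniteDimensional ℝ E] in
lemma dataSpan_init_le {k : ℕ} (xs : Fin (k + 1) → E) :
    dataSpan (Fin.init xs) ≤ dataSpan xs :=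
  span_mono (range_subset_iff.2 fun i => ⟨i.castSucc, rfl⟩)

lemma residual_last_mem {k : ℕ} (xs : Fin (k + 1) → E) :
    (dataSpan (Fin.init xs))ᗮ.starProjection (xs (Fin.last k)) ∈ dataSpan xs := by
  rw [starProjection_orthogonal_val]
  exact sub_mem (subset_span ⟨_, rfl⟩) (dataSpan_init_le xs (starProjection_apply_mem _ _))

lemma interp_mem : ∀ {k : ℕ} (xs : Fin k → E) (ys : Fin k → ℝ), interp xs ys ∈ dataSpan xs
  | 0, _, _ => zero_mem _
  | _ + 1, xs, _ => add_mem (dataSpan_init_le xs (interp_mem _ _))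
      (smul_mem _ _ (residual_last_mem xs))

lemma inner_starProjection_orthogonal (S : Submodule ℝ E) {u : E} (hu : u ∈ S) (x : E) :
    ⟪u, Sᗮ.starProjection x⟫ = 0 :=
  inner_right_of_mem_orthogonal hu (starProjection_apply_mem _ _)

lemma inner_starProjection_self (S : Submodule ℝ E) (x : E) :
    ⟪x, S.starProjection x⟫ = ‖S.starProjection x‖ ^ 2 := by
  rw [← real_inner_self_eq_norm_sq, inner_starProjection_left_eq_right,
    starProjection_eq_self_iff.2 (starProjection_apply_mem _ _)]

lemma inner_interp : ∀ {k : ℕ} {xs : Fin k → E} (ys : Fin k → ℝ),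
    LinearIndependent ℝ xs → ∀ i, ⟪xs i, interp xs ys⟫ = ys i
  | 0, _, _, _, i => i.elim0
  | k + 1, xs, ys, h, i => by
    obtain ⟨h1, h2⟩ := linearIndependent_finSucc'.1 h
    have hq : (dataSpan (Fin.init xs))ᗮ.starProjection (xs (Fin.last k)) ≠ 0 := by
      rw [starProjection_orthogonal_val, sub_ne_zero]
      intro h0
      exact h2 (starProjection_eq_self_iff.1 h0.symm)
    rw [interp, inner_add_right, real_inner_smul_right]
    refine Fin.lastCases ?_ (fun j => ?_) i
    · rw [inner_starProjection_self, div_mul_cancel₀ _ (by simpa using hq)]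
      ring
    · have h3 : xs j.castSucc ∈ dataSpan (Fin.init xs) := subset_span ⟨j, rfl⟩
      rw [inner_starProjection_orthogonal _ h3, mul_zero, add_zero]
      exact inner_interp (Fin.init ys) h1 j

omit [FiniteDimensional ℝ E] in
lemma eq_of_mem_dataSpan {k : ℕ} {xs : Fin k → E} {u v : E} (hu : u ∈ dataSpan xs)
    (hv : v ∈ dataSpan xs) (h : ∀ i, ⟪xs i, u⟫ = ⟪xs i, v⟫) : u = v := by
  have h1 : u - v ∈ (dataSpan xs)ᗮ := by
    rw [mem_orthogonal]
    intro w hw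
    induction hw using span_induction with
    | mem x hx =>
      obtain ⟨i, rfl⟩ := hx
      rw [inner_sub_right, h, sub_self]
    | zero => simp
    | add x y _ _ hx hy => rw [inner_add_left, hx, hy, add_zero]
    | smul a x _ hx => rw [real_inner_smul_left, hx, mul_zero]
  have h2 := inner_right_of_mem_orthogonal (sub_mem hu hv) h1
  exact sub_eq_zero.1 (inner_self_eq_zero.1 h2)

/-- A Gram–Schmidt step. No independence is needed: if the new vector has zero residual, the added
term vanishes with it. -/
lemma starProjection_dataSpan_succ {k : ℕ} (xs : Fin (k + 1) → E) (v : E) :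
    (dataSpan xs).starProjection v = (dataSpan (Fin.init xs)).starProjection v +
      (⟪(dataSpan (Fin.init xs))ᗮ.starProjection (xs (Fin.last k)), v⟫ /
        ‖(dataSpan (Fin.init xs))ᗮ.starProjection (xs (Fin.last k))‖ ^ 2) •
        (dataSpan (Fin.init xs))ᗮ.starProjection (xs (Fin.last k)) := by
  set S := dataSpan (Fin.init xs) with hS
  set q := Sᗮ.starProjection (xs (Fin.last k)) with hq
  have hqS : q ∈ Sᗮ := starProjection_apply_mem _ _
  refine eq_starProjection_of_mem_of_inner_eq_zero
    (add_mem (dataSpan_init_le xs (starProjection_apply_mem _ _))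
      (smul_mem _ _ (residual_last_mem xs))) ?_
  have hq0 : ⟪v - (S.starProjection v + (⟪q, v⟫ / ‖q‖ ^ 2) • q), q⟫ = 0 := by
    rw [inner_sub_left, inner_add_left, real_inner_smul_left, real_inner_self_eq_norm_sq,
      inner_right_of_mem_orthogonal (starProjection_apply_mem S v) hqS, real_inner_comm]
    rcases eq_or_ne q 0 with h0 | h0
    · simp [h0]
    · rw [div_mul_cancel₀ _ (by simpa using h0)]
      ring
  have hs0 : ∀ s ∈ S, ⟪v - (S.starProjection v + (⟪q, v⟫ / ‖q‖ ^ 2) • q), s⟫ = 0 := by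
    intro s hs
    rw [← sub_sub, inner_sub_left, real_inner_smul_left, inner_left_of_mem_orthogonal hs hqS,
      starProjection_inner_eq_zero _ _ hs]
    simp
  intro w hw
  induction hw using span_induction with
  | mem x hx =>
    obtain ⟨i, rfl⟩ := hx
    refine Fin.lastCases ?_ (fun j => hs0 _ (subset_span ⟨j, rfl⟩)) i
    have : xs (Fin.last k) = S.starProjection (xs (Fin.last k)) + q :=
      (S.starProjection_add_starProjection_orthogonal _).symm
    rw [this, inner_add_right, hq0, hs0 _ (starProjection_apply_mem _ _), add_zero]
  | zero => simp
  | add x y _ _ hx hy => rw [inner_add_right, hx, hy, add_zero]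
  | smul a x _ hx => rw [real_inner_smul_right, hx, mul_zero]

omit [FiniteDimensional ℝ E] in
lemma norm_sq_add_smul_div {S : Submodule ℝ E} {u q : E} (hu : u ∈ S) (hq : q ∈ Sᗮ) (r : ℝ) :
    ‖u + (r / ‖q‖ ^ 2) • q‖ ^ 2 = ‖u‖ ^ 2 + r ^ 2 / ‖q‖ ^ 2 := by
  rw [norm_add_sq_real, real_inner_smul_right, inner_right_of_mem_orthogonal hu hq, norm_smul,
    mul_pow, Real.norm_eq_abs, sq_abs]
  rcases eq_or_ne q 0 with h0 | h0
  · simp [h0]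
  · have : ‖q‖ ≠ 0 := by simpa using h0
    field_simp
    ring

lemma norm_sq_interp_succ {k : ℕ} (xs : Fin (k + 1) → E) (ys : Fin (k + 1) → ℝ) :
    ‖interp xs ys‖ ^ 2 = ‖interp (Fin.init xs) (Fin.init ys)‖ ^ 2 +
      (ys (Fin.last k) - ⟪xs (Fin.last k), interp (Fin.init xs) (Fin.init ys)⟫) ^ 2 /
        ‖(dataSpan (Fin.init xs))ᗮ.starProjection (xs (Fin.last k))‖ ^ 2 := by
  rw [interp]
  exact norm_sq_add_smul_div (interp_mem _ _) (starProjection_apply_mem _ _) _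

lemma norm_sq_starProjection_dataSpan_succ {k : ℕ} (xs : Fin (k + 1) → E) (v : E) :
    ‖(dataSpan xs).starProjection v‖ ^ 2 = ‖(dataSpan (Fin.init xs)).starProjection v‖ ^ 2 +
      ⟪(dataSpan (Fin.init xs))ᗮ.starProjection (xs (Fin.last k)), v⟫ ^ 2 /
        ‖(dataSpan (Fin.init xs))ᗮ.starProjection (xs (Fin.last k))‖ ^ 2 := by
  rw [starProjection_dataSpan_succ]
  exact norm_sq_add_smul_div (starProjection_apply_mem _ _) (starProjection_apply_mem _ _) _

/-- Both sides lie in the span and have the same inner products with its generators. Subtracting a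
projection is thus a change of labels. -/
lemma interp_sub_starProjection {k : ℕ} {xs : Fin k → E} (h : LinearIndependent ℝ xs)
    (ys : Fin k → ℝ) (d : E) :
    interp xs ys - (dataSpan xs).starProjection d = interp xs (fun i => ys i - ⟪xs i, d⟫) := by
  refine eq_of_mem_dataSpan (sub_mem (interp_mem _ _) (starProjection_apply_mem _ _))
    (interp_mem _ _) fun i => ?_
  have hi : xs i ∈ dataSpan xs := subset_span ⟨i, rfl⟩
  rw [inner_sub_right, inner_interp _ h, inner_interp _ h, ← inner_starProjection_left_eq_right,
    starProjection_eq_self_iff.2 hi]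

lemma finrank_orthogonal_dataSpan {k : ℕ} {xs : Fin k → E} (h : LinearIndependent ℝ xs) :
    (finrank ℝ (dataSpan xs)ᗮ : ℝ) = finrank ℝ E - k := by
  have h1 := (dataSpan xs).finrank_add_finrank_orthogonal
  rw [finrank_span_eq_card h, Fintype.card_fin] at h1
  rw [← h1]
  push_cast
  ring

variable [MeasurableSpace E] [BorelSpace E]

lemma measurable_init {α : Type*} [MeasurableSpace α] {k : ℕ} :
    Measurable (fun xs : Fin (k + 1) → α => Fin.init xs) :=
  measurable_pi_iff.2 fun i => measurable_pi_apply i.castSucc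

/-- The subspace varies with the data, so measurability is read off the Gram–Schmidt recursion, an
explicit measurable formula at each step. -/
lemma measurable_starProjection_dataSpan (k : ℕ) :
    Measurable (fun a : (Fin k → E) × E => (dataSpan a.1).starProjection a.2) := by
  induction k with
  | zero =>
    have : (fun a : (Fin 0 → E) × E => (dataSpan a.1).starProjection a.2) = fun _ => 0 := by
      ext a
      simp [dataSpan, range_eq_empty]
    rw [this]
    exact measurable_const
  | succ k ih =>
    have hl : Measurable (fun a : (Fin (k + 1) → E) × E => a.1 (Fin.last k)) := by fun_prop
    have hi : Measurable (fun a : (Fin (k + 1) → E) × E => Fin.init a.1) :=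
      measurable_init.comp measurable_fst
    have h1 := ih.comp (hi.prodMk measurable_snd)
    have h2 := hl.sub (ih.comp (hi.prodMk hl))
    have h3 := h1.add (((h2.inner measurable_snd).div (h2.norm.pow_const 2)).smul h2)
    simp_rw [starProjection_dataSpan_succ, starProjection_orthogonal_val]
    exact h3

lemma measurable_starProjection_orthogonal_dataSpan (k : ℕ) :
    Measurable (fun a : (Fin k → E) × E => (dataSpan a.1)ᗮ.starProjection a.2) := by
  simp_rw [starProjection_orthogonal_val]
  exact measurable_snd.sub (measurable_starProjection_dataSpan k)

lemma measurable_interp (k : ℕ) :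
    Measurable (fun a : (Fin k → E) × (Fin k → ℝ) => interp a.1 a.2) := by
  induction k with
  | zero => exact measurable_const
  | succ k ih =>
    have hl : Measurable (fun a : (Fin (k + 1) → E) × (Fin (k + 1) → ℝ) => a.1 (Fin.last k)) := by
      fun_prop
    have hy : Measurable (fun a : (Fin (k + 1) → E) × (Fin (k + 1) → ℝ) => a.2 (Fin.last k)) := by
      fun_prop
    have hi : Measurable (fun a : (Fin (k + 1) → E) × (Fin (k + 1) → ℝ) => Fin.init a.1) :=
      measurable_init.comp measurable_fst
    have h1 := ih.comp (hi.prodMk (measurable_init.comp measurable_snd))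
    have h2 := (measurable_starProjection_orthogonal_dataSpan k).comp (hi.prodMk hl)
    have h3 := h1.add (((hy.sub (hl.inner h1)).div (h2.norm.pow_const 2)).smul h2)
    exact h3

end Interpolation

/-! ### Training as an affine projection. -/

section Training
open Module Set Submodule
open scoped RealInnerProductSpace

variable {p k : ℕ}

/-- For feasible v, the vector v - (w₀ + u) is orthogonal to all features, hence to u, which lies in
their span. Pythagoras gives both minimality and uniqueness. -/
lemma isClosest_iff_eq {xs : Fin k → Param p} (h : LinearIndependent ℝ xs) (ys : Fin k → ℝ)
    (w₀ w : Param p) :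
    IsClosest {w | ∀ i, ⟪xs i, w⟫ = ys i} w₀ w ↔
      w = w₀ + interp xs (fun i => ys i - ⟪xs i, w₀⟫) := by
  set u := interp xs (fun i => ys i - ⟪xs i, w₀⟫) with hu
  have hmem : w₀ + u ∈ {w | ∀ i, ⟪xs i, w⟫ = ys i} := fun i => by
    rw [inner_add_right, hu, inner_interp _ h]
    ring
  have hpyth : ∀ v ∈ {w | ∀ i, ⟪xs i, w⟫ = ys i},
      ‖v - w₀‖ ^ 2 = ‖w₀ + u - w₀‖ ^ 2 + ‖v - (w₀ + u)‖ ^ 2 := by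
    intro v hv
    have h0 : (dataSpan xs).starProjection (v - (w₀ + u)) = 0 := by
      refine eq_of_mem_dataSpan (starProjection_apply_mem _ _) (zero_mem _) fun i => ?_
      have hi : xs i ∈ dataSpan xs := subset_span ⟨i, rfl⟩
      rw [← inner_starProjection_left_eq_right, starProjection_eq_self_iff.2 hi, inner_sub_right,
        hv i, hmem i]
      simp
    have h1 : ⟪u, v - (w₀ + u)⟫ = 0 := by
      have hu' : (dataSpan xs).starProjection u = u :=
        starProjection_eq_self_iff.2 (interp_mem _ _)
      rw [← hu', inner_starProjection_left_eq_right, hu', h0, inner_zero_right]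
    have h2 : v - w₀ = u + (v - (w₀ + u)) := by abel
    rw [h2, norm_add_sq_real, h1]
    simp
  constructor
  · rintro ⟨hw, hle⟩
    have h1 := hle _ hmem
    rw [hpyth w hw] at h1
    have h2 : ‖w - (w₀ + u)‖ ^ 2 = 0 := le_antisymm (by linarith) (sq_nonneg _)
    exact sub_eq_zero.1 (norm_eq_zero.1 (pow_eq_zero_iff two_ne_zero |>.1 h2))
  · rintro rfl
    refine ⟨hmem, fun v hv => ?_⟩
    rw [hpyth v hv]
    exact le_add_of_nonneg_right (sq_nonneg _)

lemma existsUnique_isClosest {xs : Fin k → Param p} (h : LinearIndependent ℝ xs) (ys : Fin k → ℝ)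
    (w₀ : Param p) : ∃! w, IsClosest {w | ∀ i, ⟪xs i, w⟫ = ys i} w₀ w := by
  simp_rw [isClosest_iff_eq h]
  exact ⟨_, rfl, fun _ h => h⟩

lemma train_eq {xs : Fin k → Param p} (h : LinearIndependent ℝ xs) (ys : Fin k → ℝ)
    (w₀ : Param p) :
    train {w | ∀ i, ⟪xs i, w⟫ = ys i} w₀ = w₀ + interp xs (fun i => ys i - ⟪xs i, w₀⟫) := by
  have hex := (existsUnique_isClosest h ys w₀).exists
  rw [train, dif_pos hex]
  exact (isClosest_iff_eq h ys w₀ _).1 hex.choose_spec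

lemma modelError_add_interp {xs : Fin k → Param p} (h : LinearIndependent ℝ xs) (ys : Fin k → ℝ)
    (w₀ wstar : Param p) :
    modelError wstar (w₀ + interp xs (fun i => ys i - ⟪xs i, w₀⟫)) =
      (‖w₀ - wstar‖ ^ 2 - ‖(dataSpan xs).starProjection (w₀ - wstar)‖ ^ 2)
        + ‖interp xs (fun i => ys i - ⟪xs i, wstar⟫)‖ ^ 2 := by
  have h1 : interp xs (fun i => ys i - ⟪xs i, w₀⟫) = interp xs (fun i => ys i - ⟪xs i, wstar⟫) -
      (dataSpan xs).starProjection (w₀ - wstar) := by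
    rw [interp_sub_starProjection h]
    congr 1
    ext i
    rw [inner_sub_right]
    ring
  have h2 : w₀ + interp xs (fun i => ys i - ⟪xs i, w₀⟫) - wstar =
      interp xs (fun i => ys i - ⟪xs i, wstar⟫) + (dataSpan xs)ᗮ.starProjection (w₀ - wstar) := by
    rw [h1, starProjection_orthogonal_val]
    abel
  have h3 := norm_sq_eq_add_norm_sq_starProjection (w₀ - wstar) (dataSpan xs)
  rw [modelError, h2, norm_add_sq_real, inner_starProjection_orthogonal _ (interp_mem _ _)]
  linarith

end Training

/-! ### Expected squared norms for a batch of independent Gaussian samples. -/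

section Batch
open Module Set Submodule
open scoped RealInnerProductSpace

lemma measurePreserving_init_last {α : Type*} [MeasurableSpace α] (μ : Measure α) [SigmaFinite μ]
    (k : ℕ) : MeasurePreserving (fun b : Fin (k + 1) → α => (Fin.init b, b (Fin.last k)))
      (Measure.pi fun _ => μ) ((Measure.pi fun _ : Fin k => μ).prod μ) := by
  have h := Measure.measurePreserving_swap.comp
    (measurePreserving_piFinSuccAbove (fun _ : Fin (k + 1) => μ) (Fin.last k))
  convert! h using 1
  ext b i
  · simp [Fin.init, MeasurableEquiv.piFinSuccAbove]
  · simp [MeasurableEquiv.piFinSuccAbove]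

lemma integrable_pi_succ_of_nonneg {α : Type*} [MeasurableSpace α] {μ : Measure α} [SigmaFinite μ]
    {k : ℕ} {ψ : (Fin k → α) × α → ℝ} {g : (Fin k → α) → ℝ} (hm : Measurable ψ)
    (h0 : ∀ z, 0 ≤ ψ z)
    (hs : ∀ᵐ b ∂(Measure.pi fun _ : Fin k => μ),
      Integrable (fun s => ψ (b, s)) μ ∧ ∫ s, ψ (b, s) ∂μ = g b)
    (hg : Integrable g (Measure.pi fun _ => μ)) :
    Integrable (fun b : Fin (k + 1) → α => ψ (Fin.init b, b (Fin.last k))) (Measure.pi fun _ => μ) ∧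
      ∫ b : Fin (k + 1) → α, ψ (Fin.init b, b (Fin.last k)) ∂(Measure.pi fun _ => μ) =
        ∫ b, g b ∂(Measure.pi fun _ => μ) := by
  have hmp := measurePreserving_init_last μ k
  obtain ⟨hi, hv⟩ := integrable_prod_of_nonneg hm.aestronglyMeasurable h0 hs hg
  refine ⟨(hmp.integrable_comp hm.aestronglyMeasurable).2 hi, ?_⟩
  have hmap := integral_map hmp.measurable.aemeasurable
    (f := ψ) (by rw [hmp.map_eq]; exact hm.aestronglyMeasurable)
  rw [hmp.map_eq] at hmap
  rw [← hmap, hv]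

variable {E : Type*} [NormedAddCommGroup E] [InnerProductSpace ℝ E] [FiniteDimensional ℝ E]
  [MeasurableSpace E] [BorelSpace E]

variable (E) in
/-- The law of one sample: a centred Gaussian noise of variance `v` and a standard Gaussian
feature vector. -/
def sampleLaw (v : ℝ≥0) : Measure (ℝ × E) := (gaussianReal 0 v).prod (stdGaussian E)

instance (v : ℝ≥0) : IsProbabilityMeasure (sampleLaw E v) := by
  unfold sampleLaw
  infer_instance

variable (E) in
/-- The law of a batch of `k` independent samples. -/
def batchLaw (v : ℝ≥0) (k : ℕ) : Measure (Fin k → ℝ × E) := Measure.pi fun _ => sampleLaw E v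

instance (v : ℝ≥0) (k : ℕ) : IsProbabilityMeasure (batchLaw E v k) := by
  unfold batchLaw
  infer_instance

/-- The feature vectors of a batch. -/
def features {k : ℕ} (b : Fin k → ℝ × E) : Fin k → E := fun i => (b i).2

omit [NormedAddCommGroup E] [InnerProductSpace ℝ E] [FiniteDimensional ℝ E] [BorelSpace E] in
lemma measurable_features (k : ℕ) : Measurable (features (E := E) (k := k)) := by
  unfold features
  fun_prop

lemma ae_linearIndependent_features (v : ℝ≥0) {k : ℕ} (hk : k ≤ finrank ℝ E) :
    ∀ᵐ b ∂(batchLaw E v k), LinearIndependent ℝ (features b) := by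
  induction k with
  | zero => exact Filter.Eventually.of_forall fun b => linearIndependent_empty_type
  | succ k ih =>
    have hmp := measurePreserving_init_last (sampleLaw E v) k
    have h1 : ∀ᵐ a ∂((batchLaw E v k).prod (sampleLaw E v)), LinearIndependent ℝ (features a.1) :=
      Measure.quasiMeasurePreserving_fst.ae (ih (by omega))
    -- The new feature a.s. avoids the span of the earlier ones, a proper subspace. Stating this as
    -- "not fixed by the projection" makes the event measurable although the span varies.
    have h2 : ∀ᵐ a ∂((batchLaw E v k).prod (sampleLaw E v)),
        (dataSpan (features a.1)).starProjection a.2.2 ≠ a.2.2 := by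
      have hf : Measurable (fun a : (Fin k → ℝ × E) × (ℝ × E) => features a.1) :=
        (measurable_features k).comp measurable_fst
      have hx : Measurable (fun a : (Fin k → ℝ × E) × (ℝ × E) => a.2.2) := by fun_prop
      have hm := (measurable_starProjection_dataSpan k).comp (hf.prodMk hx)
      have hms : MeasurableSet {a : (Fin k → ℝ × E) × (ℝ × E) |
          (dataSpan (features a.1)).starProjection a.2.2 ≠ a.2.2} :=
        (measurableSet_eq_fun hm hx).compl
      rw [Measure.ae_prod_iff_ae_ae hms]
      filter_upwards [ih (by omega)] with b hb
      have hf : 0 < finrank ℝ (dataSpan (features b))ᗮ := by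
        have := finrank_orthogonal_dataSpan hb
        have hk' : ((k + 1 : ℕ) : ℝ) ≤ finrank ℝ E := by exact_mod_cast hk
        push_cast at hk'
        have : (0 : ℝ) < finrank ℝ (dataSpan (features b))ᗮ := by linarith
        exact_mod_cast this
      have h3 := Measure.quasiMeasurePreserving_snd (μ := gaussianReal 0 v).ae
        (ae_notMem_stdGaussian _ hf)
      filter_upwards [h3] with s hs h4
      exact hs (starProjection_eq_self_iff.1 h4)
    filter_upwards [hmp.quasiMeasurePreserving.ae (h1.and h2)] with b hb
    refine linearIndependent_finSucc'.2 ⟨hb.1, fun h => hb.2 (starProjection_eq_self_iff.2 h)⟩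

/-- With a_k the mean for k features and p the dimension, the Gram–Schmidt step gives a_{k+1} = a_k
+ (‖d‖² - a_k)/(p - k), solved by a_k = (k/p)‖d‖². -/
lemma integrable_norm_sq_starProjection_features (v : ℝ≥0) {k : ℕ} (hk : k ≤ finrank ℝ E) (d : E) :
    Integrable (fun b => ‖(dataSpan (features b)).starProjection d‖ ^ 2) (batchLaw E v k) ∧
      ∫ b, ‖(dataSpan (features b)).starProjection d‖ ^ 2 ∂(batchLaw E v k) =
        k / finrank ℝ E * ‖d‖ ^ 2 := by
  induction k with
  | zero =>
    have : ∀ b : Fin 0 → ℝ × E, dataSpan (features b) = ⊥ := fun b => by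
      simp [dataSpan, range_eq_empty]
    simp [this]
  | succ k ih =>
    obtain ⟨hi, hv⟩ := ih (by omega)
    have hk' : ((k + 1 : ℕ) : ℝ) ≤ finrank ℝ E := by exact_mod_cast hk
    push_cast at hk'
    have hk0 : (0 : ℝ) ≤ k := by positivity
    let ψ : (Fin k → ℝ × E) × (ℝ × E) → ℝ := fun a =>
      ‖(dataSpan (features a.1)).starProjection d‖ ^ 2 +
      ⟪(dataSpan (features a.1))ᗮ.starProjection a.2.2, d⟫ ^ 2 /
        ‖(dataSpan (features a.1))ᗮ.starProjection a.2.2‖ ^ 2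
    have hψ : Measurable ψ := by
      have hf : Measurable (fun a : (Fin k → ℝ × E) × (ℝ × E) => features a.1) :=
        (measurable_features k).comp measurable_fst
      have hx : Measurable (fun a : (Fin k → ℝ × E) × (ℝ × E) => a.2.2) := by fun_prop
      have h1 := (measurable_starProjection_dataSpan (E := E) k).comp
        (hf.prodMk (measurable_const (a := d)))
      have h2 := (measurable_starProjection_orthogonal_dataSpan (E := E) k).comp
        (hf.prodMk hx)
      exact (h1.norm.pow_const 2).add
        (((h2.inner measurable_const).pow_const 2).div (h2.norm.pow_const 2))
    have hgi := hi.add (((integrable_const (‖d‖ ^ 2)).sub hi).div_const (finrank ℝ E - k : ℝ))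
    obtain ⟨h1, h2⟩ := integrable_pi_succ_of_nonneg (μ := sampleLaw E v) hψ
      (fun z => by positivity) (g := fun b => ‖(dataSpan (features b)).starProjection d‖ ^ 2 +
        (‖d‖ ^ 2 - ‖(dataSpan (features b)).starProjection d‖ ^ 2) / (finrank ℝ E - k : ℝ)) (by
        filter_upwards [ae_linearIndependent_features v (show k ≤ finrank ℝ E by omega)] with b hb
        have hf := finrank_orthogonal_dataSpan hb
        have hf0 : 0 < finrank ℝ (dataSpan (features b))ᗮ := by
          have : (0 : ℝ) < finrank ℝ (dataSpan (features b))ᗮ := by linarith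
          exact_mod_cast this
        obtain ⟨h3, h4⟩ := integrable_inner_starProjection_sq_div_norm_sq _ hf0 d
        have h5 := h3.comp_snd (gaussianReal 0 v)
        have h6 : ∫ s, ⟪(dataSpan (features b))ᗮ.starProjection s.2, d⟫ ^ 2 /
            ‖(dataSpan (features b))ᗮ.starProjection s.2‖ ^ 2 ∂(sampleLaw E v) =
            ‖(dataSpan (features b))ᗮ.starProjection d‖ ^ 2 / (finrank ℝ E - k : ℝ) := by
          rw [← hf, ← h4, sampleLaw, integral_fun_snd (μ := gaussianReal 0 v) (f := fun x =>
            ⟪(dataSpan (features b))ᗮ.starProjection x, d⟫ ^ 2 /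
              ‖(dataSpan (features b))ᗮ.starProjection x‖ ^ 2)]
          simp
        refine ⟨(integrable_const (μ := sampleLaw E v)
          (‖(dataSpan (features b)).starProjection d‖ ^ 2)).add h5, ?_⟩
        have h7 := norm_sq_eq_add_norm_sq_starProjection d (dataSpan (features b))
        simp only [ψ]
        refine (integral_add (μ := sampleLaw E v)
          (integrable_const (‖(dataSpan (features b)).starProjection d‖ ^ 2)) h5).trans ?_
        rw [h6]
        simp [h7]) hgi
    simp_rw [norm_sq_starProjection_dataSpan_succ]
    refine ⟨h1, h2.trans ?_⟩
    have h3 := integral_add hi (((integrable_const (‖d‖ ^ 2)).sub hi).div_const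
      (finrank ℝ E - k : ℝ))
    simp only [Pi.sub_apply] at h3
    refine h3.trans ?_
    rw [integral_div, integral_sub (integrable_const _) hi, hv]
    simp only [integral_const, probReal_univ, one_smul]
    have : (finrank ℝ E : ℝ) - k ≠ 0 := by linarith
    have : (finrank ℝ E : ℝ) ≠ 0 := by linarith
    push_cast
    field_simp

/-- The minimum-norm solution of `⟪x i, u⟫ = c i * ⟪x i, d⟫ + z i`, where the batch consists of
the pairs `(z i, x i)`. -/
def maskedInterp {k : ℕ} (c : Fin k → ℝ) (d : E) (b : Fin k → ℝ × E) : E :=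
  interp (features b) fun i => c i * ⟪(b i).2, d⟫ + (b i).1

lemma measurable_maskedInterp {k : ℕ} (c : Fin k → ℝ) (d : E) :
    Measurable (maskedInterp c d) := by
  refine (measurable_interp k).comp ((measurable_features k).prodMk ?_)
  fun_prop

/-- The expected squared norm of `maskedInterp` for `k` samples in dimension `p`, where `S` is the
number of nonzero coefficients and `D` the squared norm of `d`. -/
def maskedRisk (p v k S D : ℝ) : ℝ :=
  k * v / (p - k - 1) + D * (S / p) * (1 + (k - S) / (p - k - 1))

/-- Induction on the number of samples, for all masks and all d together: when the new label
involves d, the step calls on the complementary mask and -d. The bound k + 2 ≤ p keeps p - k - 1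
positive. -/
lemma integrable_norm_sq_maskedInterp (v : ℝ≥0) {k : ℕ} (hk : k + 2 ≤ finrank ℝ E)
    (c : Fin k → ℝ) (hc : ∀ i, c i = 0 ∨ c i = 1) (d : E) :
    Integrable (fun b => ‖maskedInterp c d b‖ ^ 2) (batchLaw E v k) ∧
      ∫ b, ‖maskedInterp c d b‖ ^ 2 ∂(batchLaw E v k) =
        maskedRisk (finrank ℝ E) v k (∑ i, c i) (‖d‖ ^ 2) := by
  induction k generalizing d with
  | zero => simp [maskedInterp, interp, maskedRisk]
  | succ k ih =>
    have hc' : ∀ i, Fin.init c i = 0 ∨ Fin.init c i = 1 := fun i => hc _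
    obtain ⟨hi, hv⟩ := ih (by omega) (Fin.init c) hc' d
    obtain ⟨hi', hv'⟩ := ih (by omega) (fun i => 1 - Fin.init c i)
      (fun i => by rcases hc' i with h | h <;> simp [h]) (-d)
    obtain ⟨hP, hPv⟩ := integrable_norm_sq_starProjection_features v
      (show k ≤ finrank ℝ E by omega) d
    have hk' : ((k + 3 : ℕ) : ℝ) ≤ finrank ℝ E := by exact_mod_cast (by omega)
    push_cast at hk'
    have hk0 : (0 : ℝ) ≤ k := by positivity
    set cl := c (Fin.last k) with hcl
    let ψ : (Fin k → ℝ × E) × (ℝ × E) → ℝ := fun a =>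
      ‖maskedInterp (Fin.init c) d a.1‖ ^ 2 +
      (a.2.1 + ⟪a.2.2, cl • d - maskedInterp (Fin.init c) d a.1⟫) ^ 2 /
        ‖(dataSpan (features a.1))ᗮ.starProjection a.2.2‖ ^ 2
    have hψ : Measurable ψ := by
      have hf : Measurable (fun a : (Fin k → ℝ × E) × (ℝ × E) => features a.1) :=
        (measurable_features k).comp measurable_fst
      have hx : Measurable (fun a : (Fin k → ℝ × E) × (ℝ × E) => a.2.2) := by fun_prop
      have h1 : Measurable (fun a : (Fin k → ℝ × E) × (ℝ × E) =>
        maskedInterp (Fin.init c) d a.1) := (measurable_maskedInterp _ _).comp measurable_fst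
      have h2 := (measurable_starProjection_orthogonal_dataSpan (E := E) k).comp
        (hf.prodMk hx)
      have h4 : Measurable (fun a : (Fin k → ℝ × E) × (ℝ × E) => a.2.1) := by fun_prop
      exact (h1.norm.pow_const 2).add
        (((h4.add (hx.inner (measurable_const.sub h1))).pow_const 2).div (h2.norm.pow_const 2))
    -- The conditional mean given the first k samples; the weights 1 - cl and cl cover both values
    -- of the last mask entry in one formula.
    let g : (Fin k → ℝ × E) → ℝ := fun b => ‖maskedInterp (Fin.init c) d b‖ ^ 2 +
      ((v + ((1 - cl) * ‖maskedInterp (Fin.init c) d b‖ ^ 2 +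
        cl * ‖maskedInterp (fun i => 1 - Fin.init c i) (-d) b‖ ^ 2)) / (finrank ℝ E - k - 2 : ℝ)
      + cl * (‖d‖ ^ 2 - ‖(dataSpan (features b)).starProjection d‖ ^ 2) / (finrank ℝ E - k : ℝ))
    have hsec : ∀ᵐ b ∂(batchLaw E v k), Integrable (fun s => ψ (b, s)) (sampleLaw E v) ∧
        ∫ s, ψ (b, s) ∂(sampleLaw E v) = g b := by
      filter_upwards [ae_linearIndependent_features v (show k ≤ finrank ℝ E by omega)] with b hb
      have hf := finrank_orthogonal_dataSpan hb
      -- Before the last sample the complement has dimension p - k ≥ 3, which makes the inverse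
      -- square norm of the residual integrable.
      have hf3 : 3 ≤ finrank ℝ (dataSpan (features b))ᗮ := by
        have : ((3 : ℕ) : ℝ) ≤ finrank ℝ (dataSpan (features b))ᗮ := by
          push_cast
          linarith
        exact_mod_cast this
      set u := maskedInterp (Fin.init c) d b with hu
      have hmem : u ∈ dataSpan (features b) := interp_mem _ _
      have hPu : (dataSpan (features b)).starProjection u = u := starProjection_eq_self_iff.2 hmem
      obtain ⟨h1, h2⟩ := integrable_noise_add_inner_sq_div_norm_starProjection_sq v _ hf3
        (cl • d - u)
      refine ⟨(integrable_const (μ := sampleLaw E v) (‖u‖ ^ 2)).add h1, ?_⟩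
      simp only [ψ, ← hu]
      rw [integral_add (μ := sampleLaw E v) (integrable_const _) h1]
      rw [← sampleLaw] at h2
      rw [h2, hf]
      simp only [integral_const, probReal_univ, one_smul, g, ← hu]
      -- Relabelling u - Pd subtracts ⟪x i, d⟫ from each label: c i ⟪x i, d⟫ + z i becomes (1 - c i)
      -- ⟪x i, -d⟫ + z i, with the same noise.
      have h3 : ‖maskedInterp (fun i => 1 - Fin.init c i) (-d) b‖ ^ 2 =
          ‖(dataSpan (features b)).starProjection d - u‖ ^ 2 := by
        rw [norm_sub_rev, hu, maskedInterp, maskedInterp, interp_sub_starProjection hb]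
        congr 3
        ext i
        simp only [inner_neg_right, features]
        ring
      have h4 := norm_sq_eq_add_norm_sq_starProjection d (dataSpan (features b))
      have h5 : (dataSpan (features b))ᗮ.starProjection u = 0 := by
        rw [starProjection_orthogonal_val, hPu, sub_self]
      rw [h3, map_sub, map_sub, h5, hPu, sub_zero, map_smul, map_smul]
      rcases hc (Fin.last k) with h0 | h0
      · rw [← hcl] at h0
        simp [h0]
      · rw [← hcl] at h0
        simp [h0, h4]
    have hg1 : Integrable (fun b => ((1 - cl) * ‖maskedInterp (Fin.init c) d b‖ ^ 2 +
        cl * ‖maskedInterp (fun i => 1 - Fin.init c i) (-d) b‖ ^ 2)) (batchLaw E v k) :=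
      (hi.const_mul _).add (hi'.const_mul _)
    have hg2 : Integrable (fun b => (v + ((1 - cl) * ‖maskedInterp (Fin.init c) d b‖ ^ 2 +
        cl * ‖maskedInterp (fun i => 1 - Fin.init c i) (-d) b‖ ^ 2)) / (finrank ℝ E - k - 2 : ℝ))
        (batchLaw E v k) := ((integrable_const _).add hg1).div_const _
    have hg3 : Integrable (fun b => cl *
        (‖d‖ ^ 2 - ‖(dataSpan (features b)).starProjection d‖ ^ 2) / (finrank ℝ E - k : ℝ))
        (batchLaw E v k) := (((integrable_const _).sub hP).const_mul _).div_const _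
    have hgi : Integrable g (batchLaw E v k) := hi.add (hg2.add hg3)
    have hgv : ∫ b, g b ∂(batchLaw E v k) =
        maskedRisk (finrank ℝ E) v (k + 1 : ℕ) (∑ i, c i) (‖d‖ ^ 2) := by
      simp only [g]
      have e1 := integral_add hi (hg2.add hg3)
      simp only [Pi.add_apply] at e1
      rw [e1, integral_add hg2 hg3, integral_div, integral_div,
        integral_add (integrable_const _) hg1, integral_const_mul,
        integral_sub (integrable_const _) hP,
        integral_add (hi.const_mul _) (hi'.const_mul _), integral_const_mul, integral_const_mul,
        hv, hv', hPv]
      simp only [integral_const, probReal_univ, one_smul, Finset.sum_sub_distrib,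
        Finset.sum_const, Finset.card_univ, Fintype.card_fin, nsmul_eq_mul, mul_one, norm_neg,
        maskedRisk]
      rw [Fin.sum_univ_castSucc, ← hcl]
      have e : ∑ i, Fin.init c i = ∑ i : Fin k, c i.castSucc := rfl
      rw [e]
      generalize ∑ i : Fin k, c i.castSucc = S
      have h1 : (finrank ℝ E : ℝ) - k ≠ 0 := by linarith
      have h2 : (finrank ℝ E : ℝ) - k - 1 ≠ 0 := by linarith
      have h3 : (finrank ℝ E : ℝ) - k - 2 ≠ 0 := by linarith
      have h4 : (finrank ℝ E : ℝ) ≠ 0 := by linarith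
      have h5 : (finrank ℝ E : ℝ) - ((k + 1 : ℕ) : ℝ) - 1 = finrank ℝ E - k - 2 := by
        push_cast
        ring
      rw [h5]
      push_cast
      rcases hc (Fin.last k) with h0 | h0
      · rw [← hcl] at h0
        rw [h0]
        field_simp
        ring
      · rw [← hcl] at h0
        rw [h0]
        field_simp
        ring
    obtain ⟨h1, h2⟩ := integrable_pi_succ_of_nonneg (μ := sampleLaw E v) hψ
      (fun z => by positivity) hsec hgi
    have e : ∀ b : Fin (k + 1) → ℝ × E, ‖maskedInterp c d b‖ ^ 2 =
        ψ (Fin.init b, b (Fin.last k)) := by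
      intro b
      rw [maskedInterp, norm_sq_interp_succ]
      simp only [ψ]
      congr 3
      rw [inner_sub_right, real_inner_smul_right]
      change cl * ⟪(b (Fin.last k)).2, d⟫ + (b (Fin.last k)).1 -
        ⟪(b (Fin.last k)).2, maskedInterp (Fin.init c) d (Fin.init b)⟫ = _
      ring
    simp_rw [e]
    exact ⟨h1, h2.trans hgv⟩

end Batch

/-! ### Expected error after one training round. -/

section Risk
open Module Set Submodule
open scoped RealInnerProductSpace

variable {p k : ℕ}

/-- The result of training on a batch from the initial point `w₀`, where the label of the `i`-th
sample is generated by the parameters `wt i`. -/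
def trainBatch (wt : Fin k → Param p) (w₀ : Param p) (b : Fin k → ℝ × Param p) : Param p :=
  w₀ + interp (features b) fun i => (⟪(b i).2, wt i⟫ + (b i).1) - ⟪features b i, w₀⟫

lemma measurable_trainBatch (wt : Fin k → Param p) :
    Measurable (fun a : Param p × (Fin k → ℝ × Param p) => trainBatch wt a.1 a.2) := by
  have hf : Measurable (fun a : Param p × (Fin k → ℝ × Param p) => features a.2) :=
    (measurable_features k).comp measurable_snd
  have hy : Measurable (fun a : Param p × (Fin k → ℝ × Param p) =>
      fun i => (⟪(a.2 i).2, wt i⟫ + (a.2 i).1) - ⟪features a.2 i, a.1⟫) := by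
    unfold features
    fun_prop
  exact measurable_fst.add ((measurable_interp k).comp (hf.prodMk hy))

lemma measurable_modelError (wstar : Param p) : Measurable (modelError wstar) := by
  unfold modelError
  fun_prop

lemma modelError_trainBatch {wt : Fin k → Param p} {wstar d : Param p} {c : Fin k → ℝ}
    (hwt : ∀ i, wt i - wstar = c i • d) {b : Fin k → ℝ × Param p}
    (hb : LinearIndependent ℝ (features b)) (w₀ : Param p) :
    modelError wstar (trainBatch wt w₀ b) =
      (‖w₀ - wstar‖ ^ 2 - ‖(dataSpan (features b)).starProjection (w₀ - wstar)‖ ^ 2)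
        + ‖maskedInterp c d b‖ ^ 2 := by
  rw [trainBatch, modelError_add_interp hb, maskedInterp]
  congr 4
  ext i
  rw [← real_inner_smul_right, ← hwt, inner_sub_right]
  simp only [features]
  ring

/-- For fixed w₀ the batch average is affine in the initial squared error; integrating over the law
of w₀ preserves this form. -/
lemma integrable_modelError_trainBatch (v : ℝ≥0) (hk : k + 2 ≤ p) {wt : Fin k → Param p}
    {wstar d : Param p} {c : Fin k → ℝ} (hc : ∀ i, c i = 0 ∨ c i = 1)
    (hwt : ∀ i, wt i - wstar = c i • d) {ρ : Measure (Param p)} [IsProbabilityMeasure ρ]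
    (hρ : Integrable (modelError wstar) ρ) :
    Integrable (fun a => modelError wstar (trainBatch wt a.1 a.2))
        (ρ.prod (batchLaw (Param p) v k)) ∧
      ∫ a, modelError wstar (trainBatch wt a.1 a.2) ∂(ρ.prod (batchLaw (Param p) v k)) =
        (1 - k / p) * ∫ w, modelError wstar w ∂ρ + maskedRisk p v k (∑ i, c i) (‖d‖ ^ 2) := by
  have hp : finrank ℝ (Param p) = p := finrank_euclideanSpace_fin
  obtain ⟨hm, hmv⟩ := integrable_norm_sq_maskedInterp (E := Param p) v (by rwa [hp]) c hc d
  have hc1 := (hρ.const_mul (1 - k / p : ℝ))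
  have hc2 := integrable_const (μ := ρ) (maskedRisk p v k (∑ i, c i) (‖d‖ ^ 2))
  obtain ⟨hi, hv⟩ := integrable_prod_of_nonneg (μ := ρ) (ν := batchLaw (Param p) v k)
    (φ := fun a => modelError wstar (trainBatch wt a.1 a.2))
    ((measurable_modelError wstar).comp (measurable_trainBatch wt)).aestronglyMeasurable
    (fun a => sq_nonneg _)
    (g := fun w => (1 - k / p : ℝ) * modelError wstar w +
      maskedRisk p v k (∑ i, c i) (‖d‖ ^ 2))
    (Filter.Eventually.of_forall fun w => by
      obtain ⟨hP, hPv⟩ := integrable_norm_sq_starProjection_features (E := Param p) v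
        (k := k) (by rw [hp]; omega) (w - wstar)
      have h0 := (integrable_const (μ := batchLaw (Param p) v k) (‖w - wstar‖ ^ 2)).sub hP
      have e : (fun b => modelError wstar (trainBatch wt w b)) =ᵐ[batchLaw (Param p) v k] fun b =>
          (‖w - wstar‖ ^ 2 - ‖(dataSpan (features b)).starProjection (w - wstar)‖ ^ 2)
            + ‖maskedInterp c d b‖ ^ 2 := by
        filter_upwards [ae_linearIndependent_features (E := Param p) v (k := k)
          (by rw [hp]; omega)] with b hb
        exact modelError_trainBatch hwt hb w
      refine ⟨(h0.add hm).congr e.symm, ?_⟩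
      have h1 := integral_add h0 hm
      simp only [Pi.sub_apply] at h1
      rw [integral_congr_ae e, h1, integral_sub (integrable_const _) hP, hPv, hmv, hp]
      simp only [integral_const, probReal_univ, one_smul, modelError]
      ring) (hc1.add hc2)
  refine ⟨hi, hv.trans ?_⟩
  rw [integral_add hc1 hc2, integral_const_mul]
  simp

variable {Ω : Type*} [MeasurableSpace Ω] {P : Measure Ω} [IsProbabilityMeasure P]

lemma integrable_modelError_trainBatch_comp {v : ℝ≥0} (hk : k + 2 ≤ p) {wt : Fin k → Param p}
    {wstar d : Param p} {c : Fin k → ℝ} (hc : ∀ i, c i = 0 ∨ c i = 1)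
    (hwt : ∀ i, wt i - wstar = c i • d) {w₀ : Ω → Param p} {B : Ω → Fin k → ℝ × Param p}
    (hw₀ : AEMeasurable w₀ P) (hB : HasLaw B (batchLaw (Param p) v k) P) (hind : IndepFun w₀ B P)
    (hint : Integrable (fun ω => modelError wstar (w₀ ω)) P) :
    Integrable (fun ω => modelError wstar (trainBatch wt (w₀ ω) (B ω))) P ∧
      ∫ ω, modelError wstar (trainBatch wt (w₀ ω) (B ω)) ∂P =
        (1 - k / p) * ∫ ω, modelError wstar (w₀ ω) ∂P +
          maskedRisk p v k (∑ i, c i) (‖d‖ ^ 2) := by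
  have := Measure.isProbabilityMeasure_map hw₀
  have h0 : HasLaw w₀ (P.map w₀) P := ⟨hw₀, rfl⟩
  have hj := hind.hasLaw_prod h0 hB
  have hme := measurable_modelError wstar
  have hρ : Integrable (modelError wstar) (P.map w₀) :=
    (integrable_map_measure hme.aestronglyMeasurable hw₀).2 hint
  obtain ⟨h1, h2⟩ := integrable_modelError_trainBatch v hk hc hwt hρ
  have hm := (hme.comp (measurable_trainBatch wt))
  constructor
  · have := (integrable_map_measure (f := fun ω => (w₀ ω, B ω)) (μ := P)
      (g := fun a => modelError wstar (trainBatch wt a.1 a.2))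
      hm.aestronglyMeasurable hj.aemeasurable).1 (by rw [hj.map_eq]; exact h1)
    exact this
  · have h3 := hj.integral_comp (f := fun a => modelError wstar (trainBatch wt a.1 a.2))
      hm.aestronglyMeasurable
    have h4 := h0.integral_comp (f := modelError wstar) hme.aestronglyMeasurable
    simp only [Function.comp_def] at h3 h4
    rw [h3, h2, h4]

end Risk

/-! ### From scalar entries to independent samples and batches. -/

section Samples
open Module Set

variable {Ω : Type*} {p n M : ℕ}

/-- The noise and the feature vector of a single sample. -/
def TwoTaskData.sample (D : TwoTaskData Ω p n M) (s : Fin n ⊕ Fin n ⊕ Fin M) (ω : Ω) :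
    ℝ × Param p :=
  (D.noise s ω, WithLp.toLp 2 fun j => D.feature (s, j) ω)

lemma measurePreserving_curry {ι κ : Type*} [Fintype ι] [Fintype κ] (μ : Measure ℝ)
    [IsProbabilityMeasure μ] :
    MeasurePreserving (MeasurableEquiv.curry ι κ ℝ) (Measure.pi fun _ : ι × κ => μ)
      (Measure.pi fun _ : ι => Measure.pi fun _ : κ => μ) := by
  refine ⟨MeasurableEquiv.measurable _, ?_⟩
  have h := Measure.infinitePi_map_curry (ι := ι) (κ := κ) (X := ℝ) (fun _ _ => μ)
  simpa only [Measure.infinitePi_eq_pi] using h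

lemma measurePreserving_samples {ι : Type*} [Fintype ι] (v : ℝ≥0) :
    MeasurePreserving (fun (y : (ι × Fin p) ⊕ ι → ℝ) (s : ι) =>
        ((y (Sum.inr s), WithLp.toLp 2 fun j => y (Sum.inl (s, j))) : ℝ × Param p))
      (Measure.pi (Sum.elim (fun _ => gaussianReal 0 1) fun _ => gaussianReal 0 v))
      (Measure.pi fun _ => sampleLaw (Param p) v) := by
  have : ∀ i, SigmaFinite ((Sum.elim (fun _ => gaussianReal 0 1) fun _ => gaussianReal 0 v :
      (ι × Fin p) ⊕ ι → Measure ℝ) i) := by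
    rintro (i | i)
    · exact inferInstanceAs (SigmaFinite (gaussianReal 0 1))
    · exact inferInstanceAs (SigmaFinite (gaussianReal 0 v))
  have h1 := measurePreserving_sumPiEquivProdPi (X := fun _ : (ι × Fin p) ⊕ ι => ℝ)
    (Sum.elim (fun _ => gaussianReal 0 1) fun _ => gaussianReal 0 v)
  have h2 : MeasurePreserving (fun (y : ι → Fin p → ℝ) (s : ι) => WithLp.toLp 2 (y s))
      (Measure.pi fun _ : ι => Measure.pi fun _ : Fin p => gaussianReal 0 1)
      (Measure.pi fun _ : ι => stdGaussian (Param p)) :=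
    measurePreserving_pi _ _ fun _ => ⟨by fun_prop, map_pi_eq_stdGaussian⟩
  have h3 := h2.comp (measurePreserving_curry (ι := ι) (κ := Fin p) (gaussianReal 0 1))
  have h4 := (h3.prod (MeasurePreserving.id (Measure.pi fun _ : ι => gaussianReal 0 v))).comp h1
  have h5 := (measurePreserving_arrowProdEquivProdArrow ℝ (Param p) ι
    (fun _ => gaussianReal 0 v) (fun _ => stdGaussian (Param p))).symm
  exact h5.comp (Measure.measurePreserving_swap.comp h4)

variable [MeasurableSpace Ω] {P : Measure Ω} {σ : ℝ≥0}
  {D : TwoTaskData Ω p n M}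

/-- Regrouping the independent scalar entries sample by sample identifies the joint law as a
product. The marginals, and the independence of samples and of disjoint batches, all follow from it.
-/
lemma TwoTaskData.IsGaussian.hasLaw_samples (hD : D.IsGaussian P σ) :
    HasLaw (fun ω s => D.sample s ω) (Measure.pi fun _ => sampleLaw (Param p) (σ ^ 2)) P := by
  have h : ∀ a, HasLaw (Sum.elim D.feature D.noise a)
      (Sum.elim (fun _ => gaussianReal 0 1) (fun _ => gaussianReal 0 (σ ^ 2)) a) P := by
    rintro (a | a)
    · exact hD.feature_law a
    · exact hD.noise_law a
  have hl := hD.indep.hasLaw_pi h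
  have hmp := measurePreserving_samples (ι := Fin n ⊕ Fin n ⊕ Fin M) (p := p) (σ ^ 2)
  exact HasLaw.comp ⟨hmp.measurable.aemeasurable, hmp.map_eq⟩ hl

lemma TwoTaskData.IsGaussian.hasLaw_sample (hD : D.IsGaussian P σ) (s) :
    HasLaw (D.sample s) (sampleLaw (Param p) (σ ^ 2)) P := by
  have hmp := measurePreserving_eval (fun _ : Fin n ⊕ Fin n ⊕ Fin M =>
    sampleLaw (Param p) (σ ^ 2)) s
  exact HasLaw.comp ⟨hmp.measurable.aemeasurable, hmp.map_eq⟩ hD.hasLaw_samples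

variable [IsProbabilityMeasure P]

lemma TwoTaskData.IsGaussian.iIndepFun_sample (hD : D.IsGaussian P σ) : iIndepFun D.sample P :=
  (iIndepFun_iff_hasLaw_pi_pi hD.hasLaw_sample).2 hD.hasLaw_samples

lemma TwoTaskData.IsGaussian.hasLaw_batch (hD : D.IsGaussian P σ) {k : ℕ}
    {g : Fin k → Fin n ⊕ Fin n ⊕ Fin M} (hg : g.Injective) :
    HasLaw (fun ω i => D.sample (g i) ω) (batchLaw (Param p) (σ ^ 2) k) P :=
  (hD.iIndepFun_sample.precomp hg).hasLaw_pi fun i => hD.hasLaw_sample (g i)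

lemma TwoTaskData.IsGaussian.indepFun_batch (hD : D.IsGaussian P σ) {κ κ' : Type*} [Fintype κ]
    [Fintype κ'] {g : κ → Fin n ⊕ Fin n ⊕ Fin M} {h : κ' → Fin n ⊕ Fin n ⊕ Fin M}
    (hgh : ∀ i j, g i ≠ h j) :
    IndepFun (fun ω i => D.sample (g i) ω) (fun ω j => D.sample (h j) ω) P := by
  classical
  have hdisj : Disjoint (Finset.univ.image g) (Finset.univ.image h) := by
    rw [Finset.disjoint_left]
    intro a ha hb
    simp only [Finset.mem_image, Finset.mem_univ, true_and] at ha hb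
    obtain ⟨i, rfl⟩ := ha
    obtain ⟨j, hj⟩ := hb
    exact hgh i j hj.symm
  have hi := hD.iIndepFun_sample.indepFun_finset₀ _ _ hdisj
    fun s => (hD.hasLaw_sample s).aemeasurable
  exact hi.comp
    (φ := fun y i => y ⟨g i, Finset.mem_image_of_mem g (Finset.mem_univ i)⟩)
    (ψ := fun y j => y ⟨h j, Finset.mem_image_of_mem h (Finset.mem_univ j)⟩)
    (by fun_prop) (by fun_prop)

end Samples

/-! ### Rational identities and positivity of the constants. -/

section Algebra

variable {p n M : ℝ}

/-- Lowering both denominators to p - n - M - 1 strictly increases n/(p - n - 1) and M/(p - M - 1),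
and the coefficient of the former is at most 1 because n ≤ p. -/
lemma noise_gap_pos (hn : 0 < n) (hM : 0 < M) (hp : n + M + 1 < p) :
    0 < (n + M) / (p - n - M - 1) - (1 - M / p + n * M / p ^ 2) * (n / (p - n - 1))
      - M / (p - M - 1) := by
  have h0 : 0 < p - n - M - 1 := by linarith
  have hp0 : 0 < p := by linarith
  have h1 : n / (p - n - 1) < n / (p - n - M - 1) := by
    apply div_lt_div_of_pos_left hn h0
    linarith
  have h2 : M / (p - M - 1) < M / (p - n - M - 1) := by
    apply div_lt_div_of_pos_left hM h0
    linarith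
  have h3 : 1 - M / p + n * M / p ^ 2 ≤ 1 := by
    have : n * M / p ^ 2 ≤ M / p := by
      rw [div_le_div_iff₀ (by positivity) hp0]
      nlinarith [mul_pos hM hp0]
    linarith
  have h4 : 0 ≤ n / (p - n - 1) := div_nonneg hn.le (by linarith)
  have h5 := mul_le_mul_of_nonneg_right h3 h4
  rw [add_div]
  linarith

lemma coupling_pos (hn : 0 < n) (hM : 0 < M) (hp : n + M + 1 < p) :
    0 < n * M / p ^ 2 * (1 - n / p) := by
  have hp0 : 0 < p := by linarith
  have : n / p < 1 := by
    rw [div_lt_one hp0]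
    linarith
  have : 0 < 1 - n / p := by linarith
  positivity

lemma constants_pos (hn : 0 < n) (hM : 0 < M) (hp : n + M + 1 < p) :
    0 < xi₁ p n M ∧ 0 < xi₂ p n M ∧ 0 < mu₁ p n M ∧ 0 < mu₂ p n M := by
  have h0 : 0 < p - n - M - 1 := by linarith
  have hp0 : 0 < p := by linarith
  have hK := coupling_pos hn hM hp
  have hN := noise_gap_pos hn hM hp
  have h1 : 0 < 1 / p - n / p ^ 2 := by
    have e : 1 / p - n / p ^ 2 = (p - n) / p ^ 2 := by
      field_simp
    rw [e]
    exact div_pos (by linarith) (by positivity)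
  refine ⟨div_pos (by positivity) hK, div_pos hN hK, div_pos ?_ hK, ?_⟩
  · rw [add_sub_assoc]
    positivity
  · exact div_pos (by linarith) hK

lemma one_lt_div_iff_of_sub_eq {a b K x w : ℝ} (hK : 0 < K) (hw : 0 < w)
    (h : a - b = K * (x - w)) : a > b ↔ x / w > 1 := by
  rw [gt_iff_lt, gt_iff_lt, one_lt_div hw, ← sub_pos, h, mul_pos_iff_of_pos_left hK, sub_pos]

/-- The left side composes the one-round affine maps for concurrent minus sequential rehearsal; v,
W, D stand for σ², ‖w₁*‖², ‖w₁* - w₂*‖². -/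
lemma forgetting_gap (hn : 0 < n) (hM : 0 < M) (hp : n + M + 1 < p) (v W D : ℝ) :
    ((1 - (n + M) / p) * ((1 - n / p) * W + maskedRisk p v n 0 0) + maskedRisk p v (n + M) n D) -
      ((1 - M / p) * ((1 - n / p) * ((1 - n / p) * W + maskedRisk p v n 0 0)
        + maskedRisk p v n n D) + maskedRisk p v M 0 0) =
      n * M / p ^ 2 * (1 - n / p) * ((xi₁ p n M * D + xi₂ p n M * v) - W) := by
  have hK := (coupling_pos hn hM hp).ne'
  have e : n * M / p ^ 2 * (1 - n / p) * ((xi₁ p n M * D + xi₂ p n M * v) - W) =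
      (n * M / p * (1 / (p - n - M - 1) + 1 / p)) * D +
      ((n + M) / (p - n - M - 1) - (1 - M / p + n * M / p ^ 2) * (n / (p - n - 1))
        - M / (p - M - 1)) * v - n * M / p ^ 2 * (1 - n / p) * W := by
    rw [xi₁, xi₂]
    -- K only has to cancel against the denominators of the constants, so it stays opaque here.
    generalize n * M / p ^ 2 * (1 - n / p) = K at *
    field_simp
  rw [e]
  simp only [maskedRisk]
  have h1 : p - n - M - 1 ≠ 0 := by linarith
  have h1' : p - (n + M) - 1 = p - n - M - 1 := by ring
  have h2 : p - n - 1 ≠ 0 := by linarith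
  have h3 : p - M - 1 ≠ 0 := by linarith
  have h4 : p ≠ 0 := by linarith
  rw [h1']
  field_simp
  ring

lemma generalization_gap (hn : 0 < n) (hM : 0 < M) (hp : n + M + 1 < p) (v W₁ W₂ D : ℝ) :
    (((1 - (n + M) / p) * ((1 - n / p) * W₁ + maskedRisk p v n 0 0) + maskedRisk p v (n + M) n D)
      + ((1 - (n + M) / p) * ((1 - n / p) * W₂ + maskedRisk p v n n D)
        + maskedRisk p v (n + M) M D)) -
      (((1 - M / p) * ((1 - n / p) * ((1 - n / p) * W₁ + maskedRisk p v n 0 0)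
        + maskedRisk p v n n D) + maskedRisk p v M 0 0) +
      ((1 - M / p) * ((1 - n / p) * ((1 - n / p) * W₂ + maskedRisk p v n n D)
        + maskedRisk p v n 0 0) + maskedRisk p v M M D)) =
      n * M / p ^ 2 * (1 - n / p) * ((mu₁ p n M * D + mu₂ p n M * v) - (W₁ + W₂)) := by
  have hK := (coupling_pos hn hM hp).ne'
  have e : n * M / p ^ 2 * (1 - n / p) * ((mu₁ p n M * D + mu₂ p n M * v) - (W₁ + W₂)) =
      (n * M / p * (2 / (p - n - M - 1) + 1 / p - n / p ^ 2)) * D +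
      2 * ((n + M) / (p - n - M - 1) - (1 - M / p + n * M / p ^ 2) * (n / (p - n - 1))
        - M / (p - M - 1)) * v - n * M / p ^ 2 * (1 - n / p) * (W₁ + W₂) := by
    rw [mu₁, mu₂]
    generalize n * M / p ^ 2 * (1 - n / p) = K at *
    field_simp
  rw [e]
  simp only [maskedRisk]
  have h1 : p - n - M - 1 ≠ 0 := by linarith
  have h1' : p - (n + M) - 1 = p - n - M - 1 := by ring
  have h2 : p - n - 1 ≠ 0 := by linarith
  have h3 : p - M - 1 ≠ 0 := by linarith
  have h4 : p ≠ 0 := by linarith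
  rw [h1']
  field_simp
  ring

end Algebra

/-! ### The training problems as linear systems of batches. -/

section Problems
open scoped RealInnerProductSpace

variable {p n M : ℕ}

lemma fits_outputs_eq {m : ℕ} (X : Matrix (Fin p) (Fin m) ℝ) (w : Param p) (z : Fin m → ℝ) :
    fits X (outputs X w z) = {u | ∀ i, ⟪(WithLp.toLp 2 fun j => X j i : Param p), u⟫ =
      ⟪(WithLp.toLp 2 fun j => X j i : Param p), w⟫ + z i} := by
  have h : ∀ (u : Param p) (i : Fin m), Matrix.mulVec X.transpose u.ofLp i =
      ⟪(WithLp.toLp 2 fun j => X j i : Param p), u⟫ := by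
    intro u i
    simp [Matrix.mulVec, dotProduct, PiLp.inner_apply, mul_comm]
  ext u
  simp only [fits, outputs, Set.mem_ofPred_eq, funext_iff, Pi.add_apply, h]

/-- The solution set of the constraints given by a batch whose `i`-th label is generated by the
parameters `wt i`. -/
def batchConstraint {k : ℕ} (wt : Fin k → Param p) (b : Fin k → ℝ × Param p) : Set (Param p) :=
  {u | ∀ i, ⟪features b i, u⟫ = ⟪(b i).2, wt i⟫ + (b i).1}

namespace TwoTaskData

variable {Ω : Type*} (D : TwoTaskData Ω p n M) (w₁star w₂star : Param p)

/-- The sample of the concurrent rehearsal batch with a given index. -/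
def concurrentIndex (i : Fin (n + M)) : Fin n ⊕ Fin n ⊕ Fin M := Sum.inr (finSumFinEquiv.symm i)

/-- The batch of the first task. -/
def batch₁ (ω : Ω) (i : Fin n) : ℝ × Param p := D.sample (Sum.inl i) ω

/-- The batch of the second task. -/
def batch₂ (ω : Ω) (i : Fin n) : ℝ × Param p := D.sample (Sum.inr (Sum.inl i)) ω

/-- The memory batch. -/
def batchMem (ω : Ω) (i : Fin M) : ℝ × Param p := D.sample (Sum.inr (Sum.inr i)) ω

/-- The batch of the second task followed by the memory batch. -/
def batchJoint (ω : Ω) (i : Fin (n + M)) : ℝ × Param p := D.sample (concurrentIndex i) ω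

/-- A quantity attached to the joint batch: `a` for the samples of the second task and `b` for the
memory samples. -/
def blocks {α : Type*} (n M : ℕ) (a b : α) (i : Fin (n + M)) : α :=
  Sum.elim (fun _ => a) (fun _ => b) (finSumFinEquiv.symm i)

lemma fitsTask₁_eq (ω : Ω) :
    D.fitsTask₁ w₁star ω = batchConstraint (fun _ => w₁star) (D.batch₁ ω) :=
  fits_outputs_eq _ _ _

lemma fitsTask₂_eq (ω : Ω) :
    D.fitsTask₂ w₂star ω = batchConstraint (fun _ => w₂star) (D.batch₂ ω) :=
  fits_outputs_eq _ _ _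

lemma fitsMemory_eq (ω : Ω) :
    D.fitsMemory w₁star ω = batchConstraint (fun _ => w₁star) (D.batchMem ω) :=
  fits_outputs_eq _ _ _

/-- The intersection is a single system of n + M equations, so concurrent rehearsal is one round
with labels from two parameters. -/
lemma fitsJoint_eq (ω : Ω) :
    D.fitsTask₂ w₂star ω ∩ D.fitsMemory w₁star ω =
      batchConstraint (blocks n M w₂star w₁star) (D.batchJoint ω) := by
  rw [fitsTask₂_eq, fitsMemory_eq]
  ext u
  simp only [batchConstraint, Set.mem_inter_iff, Set.mem_ofPred_eq, features, batchJoint, batch₂,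
    batchMem, concurrentIndex, blocks]
  rw [finSumFinEquiv.symm.forall_congr_left]
  simp [Sum.forall]

end TwoTaskData

lemma existsUnique_isClosest_batchConstraint {k : ℕ} (wt : Fin k → Param p)
    {b : Fin k → ℝ × Param p} (hb : LinearIndependent ℝ (features b)) (w₀ : Param p) :
    ∃! w, IsClosest (batchConstraint wt b) w₀ w :=
  existsUnique_isClosest hb _ w₀

lemma train_batchConstraint {k : ℕ} (wt : Fin k → Param p) {b : Fin k → ℝ × Param p}
    (hb : LinearIndependent ℝ (features b)) (w₀ : Param p) :
    train (batchConstraint wt b) w₀ = trainBatch wt w₀ b :=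
  train_eq hb _ w₀

lemma sum_blocks (a b : ℝ) : ∑ i, TwoTaskData.blocks n M a b i = n * a + M * b := by
  unfold TwoTaskData.blocks
  rw [Equiv.sum_comp finSumFinEquiv.symm (fun s => Sum.elim (fun _ => a) (fun _ => b) s),
    Fintype.sum_sum_type]
  simp

end Problems

/-! ### Expected errors of the two strategies. -/

section Errors
open Module

variable {Ω : Type*} [MeasurableSpace Ω] {P : Measure Ω} [IsProbabilityMeasure P] {σ : ℝ≥0}
  {p n M : ℕ} {D : TwoTaskData Ω p n M}

namespace TwoTaskData

lemma concurrentIndex_injective :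
    (concurrentIndex : Fin (n + M) → Fin n ⊕ Fin n ⊕ Fin M).Injective :=
  Sum.inr_injective.comp finSumFinEquiv.symm.injective

namespace IsGaussian

lemma ae_linearIndependent (hD : D.IsGaussian P σ) {k : ℕ} (hk : k ≤ p)
    {g : Fin k → Fin n ⊕ Fin n ⊕ Fin M} (hg : g.Injective) :
    ∀ᵐ ω ∂P, LinearIndependent ℝ (features fun i => D.sample (g i) ω) := by
  have hl := hD.hasLaw_batch hg
  have h := ae_linearIndependent_features (E := Param p) (σ ^ 2) (k := k)
    (by rwa [finrank_euclideanSpace_fin])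
  rw [← hl.map_eq] at h
  exact ae_of_ae_map hl.aemeasurable h

lemma ae_linearIndependent_batches (hD : D.IsGaussian P σ) (hp : n + M ≤ p) :
    ∀ᵐ ω ∂P, LinearIndependent ℝ (features (D.batch₁ ω)) ∧
      LinearIndependent ℝ (features (D.batch₂ ω)) ∧
      LinearIndependent ℝ (features (D.batchMem ω)) ∧
      LinearIndependent ℝ (features (D.batchJoint ω)) := by
  filter_upwards [hD.ae_linearIndependent (show n ≤ p by omega) Sum.inl_injective,
    hD.ae_linearIndependent (show n ≤ p by omega) (Sum.inr_injective.comp Sum.inl_injective),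
    hD.ae_linearIndependent (show M ≤ p by omega) (Sum.inr_injective.comp Sum.inr_injective),
    hD.ae_linearIndependent hp concurrentIndex_injective] with ω h1 h2 h3 h4
  exact ⟨h1, h2, h3, h4⟩

variable (w₁star w₂star : Param p)

lemma ae_existsUnique (hD : D.IsGaussian P σ) (hp : n + M ≤ p) :
    ∀ᵐ ω ∂P,
      (∃! w, IsClosest (D.fitsTask₁ w₁star ω) 0 w) ∧
      (∃! w, IsClosest (D.fitsTask₂ w₂star ω ∩ D.fitsMemory w₁star ω)
        (D.afterTask₁ w₁star ω) w) ∧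
      (∃! w, IsClosest (D.fitsTask₂ w₂star ω) (D.afterTask₁ w₁star ω) w) ∧
      (∃! w, IsClosest (D.fitsMemory w₁star ω) (D.sequentialStage w₁star w₂star ω) w) := by
  filter_upwards [hD.ae_linearIndependent_batches hp] with ω ⟨h1, h2, h3, h4⟩
  rw [fitsJoint_eq, fitsTask₁_eq, fitsTask₂_eq, fitsMemory_eq]
  exact ⟨existsUnique_isClosest_batchConstraint _ h1 _,
    existsUnique_isClosest_batchConstraint _ h4 _, existsUnique_isClosest_batchConstraint _ h2 _,
    existsUnique_isClosest_batchConstraint _ h3 _⟩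

lemma ae_train_eq (hD : D.IsGaussian P σ) (hp : n + M ≤ p) :
    ∀ᵐ ω ∂P,
      D.afterTask₁ w₁star ω = trainBatch (fun _ => w₁star) 0 (D.batch₁ ω) ∧
      D.concurrent w₁star w₂star ω =
        trainBatch (blocks n M w₂star w₁star) (D.afterTask₁ w₁star ω) (D.batchJoint ω) ∧
      D.sequentialStage w₁star w₂star ω =
        trainBatch (fun _ => w₂star) (D.afterTask₁ w₁star ω) (D.batch₂ ω) ∧
      D.sequential w₁star w₂star ω =
        trainBatch (fun _ => w₁star) (D.sequentialStage w₁star w₂star ω) (D.batchMem ω) := by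
  filter_upwards [hD.ae_linearIndependent_batches hp] with ω ⟨h1, h2, h3, h4⟩
  refine ⟨?_, ?_, ?_, ?_⟩
  · rw [afterTask₁, fitsTask₁_eq, train_batchConstraint _ h1]
  · rw [concurrent, fitsJoint_eq, train_batchConstraint _ h4]
  · rw [sequentialStage, fitsTask₂_eq, train_batchConstraint _ h2]
  · rw [sequential, fitsMemory_eq, train_batchConstraint _ h3]

omit [IsProbabilityMeasure P] in
lemma aemeasurable_batch (hD : D.IsGaussian P σ) {κ : Type*}
    (g : κ → Fin n ⊕ Fin n ⊕ Fin M) [Countable κ] :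
    AEMeasurable (fun ω i => D.sample (g i) ω) P :=
  aemeasurable_pi_lambda _ fun i => (hD.hasLaw_sample (g i)).aemeasurable

lemma aemeasurable_afterTask₁ (hD : D.IsGaussian P σ) (hp : n + M ≤ p) :
    AEMeasurable (D.afterTask₁ w₁star) P := by
  have hm : Measurable (trainBatch (k := n) (fun _ => w₁star) 0) :=
    (measurable_trainBatch _).comp (measurable_const.prodMk measurable_id)
  refine (hm.comp_aemeasurable (hD.aemeasurable_batch fun i : Fin n => Sum.inl i)).congr ?_
  -- Only the statement about task 1 is used, so the second parameter 0 is a dummy.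
  filter_upwards [hD.ae_train_eq w₁star 0 hp] with ω h
  exact h.1.symm

lemma indepFun_afterTask₁ (hD : D.IsGaussian P σ) (hp : n + M ≤ p) {k : ℕ}
    {g : Fin k → Fin n ⊕ Fin n ⊕ Fin M} (hg : ∀ i j, Sum.inl i ≠ g j) :
    IndepFun (D.afterTask₁ w₁star) (fun ω i => D.sample (g i) ω) P := by
  have hm : Measurable (trainBatch (k := n) (fun _ => w₁star) 0) :=
    (measurable_trainBatch _).comp (measurable_const.prodMk measurable_id)
  have hi := (hD.indepFun_batch hg).comp hm measurable_id
  refine hi.congr ?_ (ae_eq_refl _)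
  filter_upwards [hD.ae_train_eq w₁star 0 hp] with ω h
  exact h.1.symm

/-- Exhibits the intermediate parameters a.s. as a function of the samples of tasks 1 and 2 alone,
which gives their independence from the memory. -/
lemma ae_sequentialStage_eq (hD : D.IsGaussian P σ) (hp : n + M ≤ p) :
    (fun y : Fin n ⊕ Fin n → ℝ × Param p => trainBatch (fun _ => w₂star)
      (trainBatch (fun _ => w₁star) 0 fun i => y (Sum.inl i)) fun i => y (Sum.inr i)) ∘
      (fun ω i => D.sample (Sum.elim Sum.inl (Sum.inr ∘ Sum.inl) i) ω) =ᵐ[P]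
      D.sequentialStage w₁star w₂star := by
  filter_upwards [hD.ae_train_eq w₁star w₂star hp] with ω ⟨h1, _, h3, _⟩
  rw [h3, h1]
  rfl

lemma measurable_stage : Measurable (fun y : Fin n ⊕ Fin n → ℝ × Param p =>
    trainBatch (fun _ => w₂star) (trainBatch (fun _ => w₁star) 0 fun i => y (Sum.inl i))
      fun i => y (Sum.inr i)) := by
  have h1 : Measurable (fun y : Fin n ⊕ Fin n → ℝ × Param p => fun i => y (Sum.inl i)) := by
    fun_prop
  have h2 : Measurable (fun y : Fin n ⊕ Fin n → ℝ × Param p => fun i => y (Sum.inr i)) := by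
    fun_prop
  have h3 := (measurable_trainBatch fun _ => w₁star).comp
    ((measurable_const (a := (0 : Param p))).prodMk h1)
  exact (measurable_trainBatch _).comp (h3.prodMk h2)

lemma aemeasurable_sequentialStage (hD : D.IsGaussian P σ) (hp : n + M ≤ p) :
    AEMeasurable (D.sequentialStage w₁star w₂star) P :=
  ((measurable_stage w₁star w₂star).comp_aemeasurable (hD.aemeasurable_batch _)).congr
    (hD.ae_sequentialStage_eq w₁star w₂star hp)

lemma indepFun_sequentialStage (hD : D.IsGaussian P σ) (hp : n + M ≤ p) :
    IndepFun (D.sequentialStage w₁star w₂star) D.batchMem P := by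
  have hi := (hD.indepFun_batch (g := Sum.elim Sum.inl (Sum.inr ∘ Sum.inl))
    (h := fun i : Fin M => Sum.inr (Sum.inr i)) (by rintro (i | i) j <;> simp)).comp
    (measurable_stage w₁star w₂star) measurable_id
  exact hi.congr (hD.ae_sequentialStage_eq w₁star w₂star hp) (ae_eq_refl _)

lemma modelError_afterTask₁ (hD : D.IsGaussian P σ) (hn : n + 2 ≤ p) (hp : n + M ≤ p)
    {wstar d : Param p} {c : ℝ} (hc : c = 0 ∨ c = 1) (hd : w₁star - wstar = c • d) :
    Integrable (fun ω => modelError wstar (D.afterTask₁ w₁star ω)) P ∧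
      ∫ ω, modelError wstar (D.afterTask₁ w₁star ω) ∂P =
        (1 - n / p) * ‖wstar‖ ^ 2 + maskedRisk p (σ ^ 2 : ℝ≥0) n (n * c) (‖d‖ ^ 2) := by
  obtain ⟨h1, h2⟩ := integrable_modelError_trainBatch_comp (P := P) hn
    (wt := fun _ : Fin n => w₁star) (c := fun _ => c) (fun _ => hc) (fun _ => hd)
    (w₀ := fun _ => 0) aemeasurable_const (hD.hasLaw_batch Sum.inl_injective)
    (indepFun_const_left _ _) (integrable_const _)
  have e : (fun ω => modelError wstar (trainBatch (fun _ => w₁star) 0 fun i =>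
      D.sample (Sum.inl i) ω)) =ᵐ[P] fun ω => modelError wstar (D.afterTask₁ w₁star ω) := by
    filter_upwards [hD.ae_train_eq w₁star 0 hp] with ω h
    rw [h.1]
    rfl
  refine ⟨h1.congr e, ?_⟩
  rw [← integral_congr_ae e, h2]
  simp [modelError]

/-- The masks a (task 2) and b (memory) are 1, 0 when the error is measured from w₁* and 0, 1 when
measured from w₂*. -/
lemma modelError_concurrent (hD : D.IsGaussian P σ) (hn : n + M + 2 ≤ p)
    {wstar d : Param p} {a b : ℝ} (ha : a = 0 ∨ a = 1) (hb : b = 0 ∨ b = 1)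
    (had : w₂star - wstar = a • d) (hbd : w₁star - wstar = b • d)
    (hint : Integrable (fun ω => modelError wstar (D.afterTask₁ w₁star ω)) P) :
    Integrable (fun ω => modelError wstar (D.concurrent w₁star w₂star ω)) P ∧
      ∫ ω, modelError wstar (D.concurrent w₁star w₂star ω) ∂P =
        (1 - (n + M) / p) * ∫ ω, modelError wstar (D.afterTask₁ w₁star ω) ∂P +
          maskedRisk p (σ ^ 2 : ℝ≥0) (n + M) (n * a + M * b) (‖d‖ ^ 2) := by
  have hp : n + M ≤ p := by omega
  have hsplit : ∀ {q : Fin n ⊕ Fin M → Prop}, (∀ s, q s) → ∀ i : Fin (n + M),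
    q (finSumFinEquiv.symm i) := fun h i => h _
  obtain ⟨h1, h2⟩ := integrable_modelError_trainBatch_comp (P := P) hn
    (wt := blocks n M w₂star w₁star) (wstar := wstar) (d := d) (c := blocks n M a b)
    (hsplit (q := fun s => Sum.elim (fun _ => a) (fun _ => b) s = 0 ∨
      Sum.elim (fun _ => a) (fun _ => b) s = 1) (by rintro (s | s) <;> simpa))
    (hsplit (q := fun s => Sum.elim (fun _ => w₂star) (fun _ => w₁star) s - wstar =
      (Sum.elim (fun _ => a) (fun _ => b) s : ℝ) • d) (by rintro (s | s) <;> simpa))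
    (hD.aemeasurable_afterTask₁ w₁star hp) (hD.hasLaw_batch concurrentIndex_injective)
    (hD.indepFun_afterTask₁ w₁star hp (by simp [concurrentIndex])) hint
  have e : (fun ω => modelError wstar (trainBatch (blocks n M w₂star w₁star)
      (D.afterTask₁ w₁star ω) fun i => D.sample (concurrentIndex i) ω)) =ᵐ[P]
      fun ω => modelError wstar (D.concurrent w₁star w₂star ω) := by
    filter_upwards [hD.ae_train_eq w₁star w₂star hp] with ω h
    rw [h.2.1]
    rfl
  refine ⟨h1.congr e, ?_⟩
  rw [← integral_congr_ae e, h2, sum_blocks]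
  push_cast
  rfl

lemma modelError_sequentialStage (hD : D.IsGaussian P σ) (hn : n + 2 ≤ p) (hp : n + M ≤ p)
    {wstar d : Param p} {c : ℝ} (hc : c = 0 ∨ c = 1) (hd : w₂star - wstar = c • d)
    (hint : Integrable (fun ω => modelError wstar (D.afterTask₁ w₁star ω)) P) :
    Integrable (fun ω => modelError wstar (D.sequentialStage w₁star w₂star ω)) P ∧
      ∫ ω, modelError wstar (D.sequentialStage w₁star w₂star ω) ∂P =
        (1 - n / p) * ∫ ω, modelError wstar (D.afterTask₁ w₁star ω) ∂P +
          maskedRisk p (σ ^ 2 : ℝ≥0) n (n * c) (‖d‖ ^ 2) := by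
  obtain ⟨h1, h2⟩ := integrable_modelError_trainBatch_comp (P := P) hn
    (wt := fun _ : Fin n => w₂star) (c := fun _ => c) (fun _ => hc) (fun _ => hd)
    (hD.aemeasurable_afterTask₁ w₁star hp)
    (hD.hasLaw_batch (Sum.inr_injective.comp Sum.inl_injective))
    (hD.indepFun_afterTask₁ w₁star hp (by simp)) hint
  have e : (fun ω => modelError wstar (trainBatch (fun _ => w₂star) (D.afterTask₁ w₁star ω)
      fun i => D.sample ((Sum.inr ∘ Sum.inl) i) ω)) =ᵐ[P]
      fun ω => modelError wstar (D.sequentialStage w₁star w₂star ω) := by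
    filter_upwards [hD.ae_train_eq w₁star w₂star hp] with ω h
    rw [h.2.2.1]
    rfl
  refine ⟨h1.congr e, ?_⟩
  rw [← integral_congr_ae e, h2]
  simp

lemma modelError_sequential (hD : D.IsGaussian P σ) (hM : M + 2 ≤ p) (hp : n + M ≤ p)
    {wstar d : Param p} {c : ℝ} (hc : c = 0 ∨ c = 1) (hd : w₁star - wstar = c • d)
    (hint : Integrable (fun ω => modelError wstar (D.sequentialStage w₁star w₂star ω)) P) :
    Integrable (fun ω => modelError wstar (D.sequential w₁star w₂star ω)) P ∧
      ∫ ω, modelError wstar (D.sequential w₁star w₂star ω) ∂P =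
        (1 - M / p) * ∫ ω, modelError wstar (D.sequentialStage w₁star w₂star ω) ∂P +
          maskedRisk p (σ ^ 2 : ℝ≥0) M (M * c) (‖d‖ ^ 2) := by
  obtain ⟨h1, h2⟩ := integrable_modelError_trainBatch_comp (P := P) hM
    (wt := fun _ : Fin M => w₁star) (c := fun _ => c) (fun _ => hc) (fun _ => hd)
    (hD.aemeasurable_sequentialStage w₁star w₂star hp)
    (hD.hasLaw_batch (Sum.inr_injective.comp Sum.inr_injective))
    (hD.indepFun_sequentialStage w₁star w₂star hp) hint
  have e : (fun ω => modelError wstar (trainBatch (fun _ => w₁star)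
      (D.sequentialStage w₁star w₂star ω) fun i => D.sample ((Sum.inr ∘ Sum.inr) i) ω)) =ᵐ[P]
      fun ω => modelError wstar (D.sequential w₁star w₂star ω) := by
    filter_upwards [hD.ae_train_eq w₁star w₂star hp] with ω h
    rw [h.2.2.2]
    rfl
  refine ⟨h1.congr e, ?_⟩
  rw [← integral_congr_ae e, h2]
  simp

end IsGaussian
end TwoTaskData
end Errors

end Rehearsal

end

/-! ### Assembly of the comparison. -/

theorem theorem2 {Ω : Type*} [MeasurableSpace Ω] (P : Measure Ω) [IsProbabilityMeasure P]
    (p n M : ℕ) (hn : 0 < n) (hM : 0 < M) (hp : n + M + 1 < p) (σ : ℝ≥0)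
    (w₁star w₂star : Rehearsal.Param p)
    (D : Rehearsal.TwoTaskData Ω p n M) (hD : D.IsGaussian P σ) :
    -- the constants are positive
    (0 < Rehearsal.xi₁ p n M ∧ 0 < Rehearsal.xi₂ p n M ∧
      0 < Rehearsal.mu₁ p n M ∧ 0 < Rehearsal.mu₂ p n M) ∧
    -- almost surely, every training problem has exactly one solution
    (∀ᵐ ω ∂P,
      (∃! w, Rehearsal.IsClosest (D.fitsTask₁ w₁star ω) 0 w) ∧
      (∃! w, Rehearsal.IsClosest (D.fitsTask₂ w₂star ω ∩ D.fitsMemory w₁star ω)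
        (D.afterTask₁ w₁star ω) w) ∧
      (∃! w, Rehearsal.IsClosest (D.fitsTask₂ w₂star ω) (D.afterTask₁ w₁star ω) w) ∧
      (∃! w, Rehearsal.IsClosest (D.fitsMemory w₁star ω)
        (D.sequentialStage w₁star w₂star ω) w)) ∧
    -- all expectations in the definitions of forgetting and generalization error are finite
    (Integrable (fun ω => Rehearsal.modelError w₁star (D.afterTask₁ w₁star ω)) P ∧
      Integrable (fun ω => Rehearsal.modelError w₁star (D.concurrent w₁star w₂star ω)) P ∧
      Integrable (fun ω => Rehearsal.modelError w₂star (D.concurrent w₁star w₂star ω)) P ∧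
      Integrable (fun ω => Rehearsal.modelError w₁star (D.sequential w₁star w₂star ω)) P ∧
      Integrable (fun ω => Rehearsal.modelError w₂star (D.sequential w₁star w₂star ω)) P) ∧
    -- comparison of the forgetting
    (w₁star ≠ 0 →
      (Rehearsal.forgetting P w₁star (D.afterTask₁ w₁star) (D.concurrent w₁star w₂star) >
          Rehearsal.forgetting P w₁star (D.afterTask₁ w₁star) (D.sequential w₁star w₂star) ↔
        (Rehearsal.xi₁ p n M * ‖w₁star - w₂star‖ ^ 2 + Rehearsal.xi₂ p n M * (σ : ℝ) ^ 2) /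
          ‖w₁star‖ ^ 2 > 1)) ∧
    -- comparison of the generalization error
    ((w₁star ≠ 0 ∨ w₂star ≠ 0) →
      (Rehearsal.generalizationError P w₁star w₂star (D.concurrent w₁star w₂star) >
          Rehearsal.generalizationError P w₁star w₂star (D.sequential w₁star w₂star) ↔
        (Rehearsal.mu₁ p n M * ‖w₁star - w₂star‖ ^ 2 + Rehearsal.mu₂ p n M * (σ : ℝ) ^ 2) /
          (‖w₁star‖ ^ 2 + ‖w₂star‖ ^ 2) > 1)) := by
  have hnR : (0 : ℝ) < n := by exact_mod_cast hn
  have hMR : (0 : ℝ) < M := by exact_mod_cast hM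
  have hpR : (n : ℝ) + M + 1 < p := by exact_mod_cast hp
  have hnM : n + M ≤ p := by omega
  have hK := Rehearsal.coupling_pos hnR hMR hpR
  -- With mask 0 the direction d is arbitrary; d = 0 brings the noise-only risk to the form
  -- `maskedRisk p v n 0 0` of the algebraic identities.
  obtain ⟨i1, v1⟩ := hD.modelError_afterTask₁ w₁star (by omega) hnM (wstar := w₁star) (d := 0)
    (Or.inl rfl) (by simp)
  obtain ⟨i2, v2⟩ := hD.modelError_afterTask₁ w₁star (by omega) hnM (wstar := w₂star)
    (d := w₁star - w₂star) (Or.inr rfl) (by simp)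
  obtain ⟨ic1, vc1⟩ := hD.modelError_concurrent w₁star w₂star (by omega)
    (d := w₂star - w₁star) (Or.inr rfl) (Or.inl rfl) (by simp) (by simp) i1
  obtain ⟨ic2, vc2⟩ := hD.modelError_concurrent w₁star w₂star (by omega)
    (d := w₁star - w₂star) (Or.inl rfl) (Or.inr rfl) (by simp) (by simp) i2
  obtain ⟨it1, vt1⟩ := hD.modelError_sequentialStage w₁star w₂star (by omega) hnM
    (d := w₂star - w₁star) (Or.inr rfl) (by simp) i1
  obtain ⟨it2, vt2⟩ := hD.modelError_sequentialStage w₁star w₂star (by omega) hnM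
    (d := 0) (Or.inl rfl) (by simp) i2
  obtain ⟨is1, vs1⟩ := hD.modelError_sequential w₁star w₂star (by omega) hnM
    (d := 0) (Or.inl rfl) (by simp) it1
  obtain ⟨is2, vs2⟩ := hD.modelError_sequential w₁star w₂star (by omega) hnM
    (d := w₁star - w₂star) (Or.inr rfl) (by simp) it2
  simp only [norm_sub_rev w₂star w₁star, mul_one, mul_zero, add_zero, zero_add, norm_zero,
    NNReal.coe_pow, ne_eq, OfNat.ofNat_ne_zero, not_false_eq_true, zero_pow]
    at v1 v2 vc1 vc2 vt1 vt2 vs1 vs2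
  have hF := Rehearsal.forgetting_gap hnR hMR hpR ((σ : ℝ) ^ 2) (‖w₁star‖ ^ 2)
    (‖w₁star - w₂star‖ ^ 2)
  have hG := Rehearsal.generalization_gap hnR hMR hpR ((σ : ℝ) ^ 2) (‖w₁star‖ ^ 2)
    (‖w₂star‖ ^ 2) (‖w₁star - w₂star‖ ^ 2)
  rw [← v1, ← vt1, ← vc1, ← vs1] at hF
  rw [← v1, ← v2, ← vt1, ← vt2, ← vc1, ← vc2, ← vs1, ← vs2] at hG
  refine ⟨Rehearsal.constants_pos hnR hMR hpR, hD.ae_existsUnique w₁star w₂star hnM,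
    ⟨i1, ic1, ic2, is1, is2⟩, fun hw => ?_, fun hw => ?_⟩
  · have hW : 0 < ‖w₁star‖ ^ 2 := by
      have := norm_pos_iff.2 hw
      positivity
    refine Rehearsal.one_lt_div_iff_of_sub_eq hK hW ?_
    -- Both strategies share the error after task 1, which cancels in the difference of forgettings.
    rw [← hF, Rehearsal.forgetting, Rehearsal.forgetting, integral_sub ic1 i1,
      integral_sub is1 i1]
    ring
  · have hW : 0 < ‖w₁star‖ ^ 2 + ‖w₂star‖ ^ 2 := by
      rcases hw with hw | hw
      · have := norm_pos_iff.2 hw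
        positivity
      · have := norm_pos_iff.2 hw
        positivity
    rw [Rehearsal.generalizationError, Rehearsal.generalizationError, gt_iff_lt,
      mul_lt_mul_iff_right₀ (by norm_num)]
    exact Rehearsal.one_lt_div_iff_of_sub_eq hK hW hG
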